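/- Let $0<\pi_1<1$ and consider hypotheses $t=1,2,\dots$ with labels $H_t\in\{0,1\}$ ($1$ = non-null), contexts $X_t$, p-values $P_t\in[0,1]$ and weights $\omega_t>0$ such that: $\Pr[H_t=1]=\pi_1$; given $H_t=0$, $X_t\sim\mathcal L_0$ and, conditionally on $X_t$, $P_t\sim\mathrm{Uniform}(0,1)$; given $H_t=1$, $X_t\sim\mathcal L_1$ and, conditionally on $X_t$, $P_t\sim F_1(\cdot\mid X_t)$ for an arbitrary conditional law $F_1$ on $[0,1]$; given $H_t=h$, $\omega_t\sim Q_h$, where $Q_0,Q_1$ are probability distributions on $(0,\infty)$; $P_t$ and $\omega_t$ are conditionally independent given $H_t$; and the triples $(H_t,P_t,\omega_t)$, $t\ge1$, are independent. Assume that the null weights have mean $u_0=\int x\,dQ_0(x)\le 1$ (in particular this covers informative weights, for which $u_0<1$, $\int x\,dQ_1(x)>1$ and $(1-\pi_1)u_0+\pi_1\int x\,dQ_1(x)=1$). Let $0<\alpha<1$, $\alpha/2\le w_0<\alpha$, $b_0=\alpha-w_0$, and let $\gamma_1\ge\gamma_2\ge\dots\ge0$ with $\sum_{t\ge1}\gamma_t=1$.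 Weighted LORD++ rejects hypothesis $t$ (that is, $R_t=1$) if and only if $P_t/\omega_t\le\alpha_t:=\gamma_{t-\tau_t}b_t$, where $\tau_t$ is the time of the last rejection before $t$ ($\tau_t=0$ if there is none), and $b_t=\alpha-w_0$ if there is no rejection before $t$, $b_t=\alpha$ otherwise. Put $\mathrm{TDP}(T)=\dfrac{\sum_{t\le T}R_tH_t}{\max\{1,\sum_{t\le T}H_t\}}$, $\mathrm{TDR}(T)=\mathbb E[\mathrm{TDP}(T)]$, and let $D(a)=\Pr[P_t/\omega_t\le a]$ be the common marginal distribution function of the weighted p-values. Then, almost surely, $$\liminf_{T\to\infty}\mathrm{TDP}(T)\;\ge\;\Big(\sum_{m=0}^{\infty}\prod_{j=1}^{m}\big(1-D(b_0\gamma_j)\big)\Big)^{-1},$$ and also $$\liminf_{T\to\infty}\mathrm{TDR}(T)\;\ge\;\Big(\sum_{m=0}^{\infty}\prod_{j=1}^{m}\big(1-D(b_0\gamma_j)\big)\Big)^{-1},$$ where the right-hand side is read as $0$ if the sum diverges (the term $m=0$ is the empty product $1$). -/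

import Mathlib

open MeasureTheory ProbabilityTheory Filter
open scoped ENNReal

/-- The two-group mixture model with random weights, for hypotheses numbered `t = 1, 2, …`
(index `0` of the sequences is never used). `H t = true` means that hypothesis `t` is non-null,
`X t` is its context, `P t` its p-value and `w t` its weight.
Only the triples `(H t, P t, w t)` are independent over `t`; the contexts may be dependent. -/
structure IsWeightedMixtureModel {Ω 𝒳 : Type*} [MeasurableSpace Ω] [MeasurableSpace 𝒳]
    (μ : Measure Ω) (π₁ : ℝ) (L₀ L₁ : Measure 𝒳) (F₁ : Kernel 𝒳 ℝ) (Q₀ Q₁ : Measure ℝ)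
    (H : ℕ → Ω → Bool) (X : ℕ → Ω → 𝒳) (P w : ℕ → Ω → ℝ) : Prop where
  measurable_H : ∀ t, 1 ≤ t → Measurable (H t)
  measurable_X : ∀ t, 1 ≤ t → Measurable (X t)
  measurable_P : ∀ t, 1 ≤ t → Measurable (P t)
  measurable_w : ∀ t, 1 ≤ t → Measurable (w t)
  /-- The laws of the p-values under the alternative live on `[0, 1]`. -/
  alt_support : ∀ x, F₁ x (Set.Icc 0 1) = 1
  /-- The laws of the weights live on `(0, ∞)`. -/
  null_weight_pos : Q₀ (Set.Ioi 0) = 1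
  alt_weight_pos : Q₁ (Set.Ioi 0) = 1
  /-- `H t` is Bernoulli with parameter `π₁`. -/
  prob_alt : ∀ t, 1 ≤ t → μ {o | H t o = true} = ENNReal.ofReal π₁
  /-- Given `H t = 0`: `X t ∼ L₀`, and given `X t` moreover, `P t` is uniform on `(0, 1)`. -/
  law_null : ∀ t, 1 ≤ t →
    Measure.map (fun o => (X t o, P t o)) (cond μ {o | H t o = false})
      = L₀.prod (volume.restrict (Set.Ioo (0 : ℝ) 1))
  /-- Given `H t = 1`: `X t ∼ L₁`, and given `X t` moreover, `P t ∼ F₁ (X t)`. -/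
  law_alt : ∀ t, 1 ≤ t →
    Measure.map (fun o => (X t o, P t o)) (cond μ {o | H t o = true}) = L₁ ⊗ₘ F₁
  /-- `w t ∼ Q₀` given `H t = 0`, and `w t ∼ Q₁` given `H t = 1`. -/
  weight_null : ∀ t, 1 ≤ t → Measure.map (w t) (cond μ {o | H t o = false}) = Q₀
  weight_alt : ∀ t, 1 ≤ t → Measure.map (w t) (cond μ {o | H t o = true}) = Q₁
  /-- `P t` and `w t` are conditionally independent given `H t`. -/
  cond_indep : ∀ t, 1 ≤ t → ∀ h : Bool, IndepFun (P t) (w t) (cond μ {o | H t o = h})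
  /-- The triples `(H t, P t, w t)`, `t = 1, 2, …`, are independent. -/
  indep : iIndepFun (fun (t : ℕ) (o : Ω) => (H (t + 1) o, P (t + 1) o, w (t + 1) o)) μ

noncomputable section

/-- The multiplier `b_t` of LORD++: `α - w₀` as long as there has been no discovery before `t`,
and `α` afterwards. Here `A` is the set of the discovery times before `t`. -/
def lordMultiplier (α w₀ : ℝ) (A : Finset ℕ) : ℝ :=
  if A = ∅ then α - w₀ else α

/-- The LORD++ test level `α_t = γ_{t - τ_t} b_t`, where `A` is the set of the discovery times
before `t`, and `τ_t = A.sup id` is the largest of them (`0` if there is none). -/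
def lordLevel (α w₀ : ℝ) (γ : ℕ → ℝ) (A : Finset ℕ) (t : ℕ) : ℝ :=
  γ (t - A.sup id) * lordMultiplier α w₀ A

/-- The set of the discovery times in `{1, …, T}` when LORD++ is applied to the sequence of
p-values `p 1, p 2, …`. -/
def lordDiscoveries (α w₀ : ℝ) (γ : ℕ → ℝ) (p : ℕ → ℝ) : ℕ → Finset ℕ
  | 0 => ∅
  | T + 1 =>
    if p (T + 1) ≤ lordLevel α w₀ γ (lordDiscoveries α w₀ γ p T) (T + 1) then
      insert (T + 1) (lordDiscoveries α w₀ γ p T)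
    else lordDiscoveries α w₀ γ p T

/-- The true discovery proportion `S(T) / max (N₁(T)) 1`, where `h` tells which hypotheses are
non-null and `A` is the set of the discovery times in `{1, …, T}`. -/
def trueDiscoveryProportion (h : ℕ → Bool) (A : Finset ℕ) (T : ℕ) : ℝ :=
  ((A.filter (fun t => h t = true)).card : ℝ) /
    (max (((Finset.Icc 1 T).filter (fun t => h t = true)).card) 1 : ℕ)

/-- `TDP(T)` of weighted LORD++, that is, of LORD++ applied to the weighted p-values
`P t / w t`, at the outcome `o`. -/
def weightedLordTDP {Ω : Type*} (α w₀ : ℝ) (γ : ℕ → ℝ) (H : ℕ → Ω → Bool) (P w : ℕ → Ω → ℝ)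
    (T : ℕ) (o : Ω) : ℝ :=
  trueDiscoveryProportion (fun t => H t o)
    (lordDiscoveries α w₀ γ (fun t => P t o / w t o) T) T

/-- `TDR(T) = E[TDP(T)]`, the average power of weighted LORD++. -/
def weightedLordTDR {Ω : Type*} [MeasurableSpace Ω] (μ : Measure Ω) (α w₀ : ℝ) (γ : ℕ → ℝ)
    (H : ℕ → Ω → Bool) (P w : ℕ → Ω → ℝ) (T : ℕ) : ℝ :=
  ∫ o, weightedLordTDP α w₀ γ H P w T o ∂μ

/-- The marginal distribution function `D(a) = Pr[P / ω ≤ a]` of the weighted p-values, which are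
identically distributed in the mixture model. -/
def weightedCDF {Ω : Type*} [MeasurableSpace Ω] (μ : Measure Ω) (P w : ℕ → Ω → ℝ) (a : ℝ) :
    ℝ≥0∞ :=
  μ {o | P 1 o / w 1 o ≤ a}

/-- The reciprocal of `∑_{m ≥ 0} ∏_{j = 1}^m (1 - D (b₀ γ_j))`; it is `0` if the sum diverges. -/
def powerLowerBound (b₀ : ℝ) (γ : ℕ → ℝ) (D : ℝ → ℝ≥0∞) : ℝ≥0∞ :=
  (∑' m : ℕ, ∏ j ∈ Finset.Icc 1 m, (1 - D (b₀ * γ j)))⁻¹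

end

/-!
The levels of LORD++ are compared with those of a simpler procedure, which uses the level
`(α - w₀) * γ m` when `m` tests have been made since its last discovery, the current one included,
and has no other memory. As `γ` is nonincreasing and the multipliers of LORD++ are at least
`α - w₀`, induction shows that LORD++ always has the larger level, so that its discoveries include
all those of the simpler procedure (`card_renewal_le_card_lordDiscoveries`).

The simpler procedure is a renewal process. A cycle survives its first `m` tests with probability
`q m = ∏ (1 - D ((α - w₀) * γ j))`, so its mean length is `Λ = ∑ q m`. A null hypothesis is rejected
at level `a` with conditional probability at most `a * u₀ ≤ a`
(`IsWeightedMixtureModel.measure_null_rejection_le`), hence a cycle ends in a false discovery with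
probability at most `(1 - π₁) * ∑ (α - w₀) * γ m ≤ 1 - π₁`, and in a true discovery with
probability at least `π₁` (`one_sub_tsum_le_tsum_renewalSurvival_mul`). True discoveries therefore
have asymptotic frequency at least `π₁ / Λ`, while non-null hypotheses have frequency `π₁`. If `Λ`
is infinite, the bound is zero and there is nothing to prove.

The renewal theorem behind this (`ae_eventually_mul_le_card_renewal`) is proved by counting, for
each age `m`, the tests made at that age. By a strong law for orthogonal random variables, the
count for age `m + 1` is asymptotically `1 - D ((α - w₀) * γ m)` times the count for age `m`. That
high ages occupy only a small proportion of the tests cannot be read off from the individual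
counts, since a cycle need not have a second moment; it follows from the maximal ergodic inequality
for the shift (`ae_forall_exists_card_renewalAge_gt_le`). The bound for the mean `TDR(T)` follows
from the almost sure one by Fatou's lemma.
-/

/-! ### Averages of orthogonal random variables -/

theorem integral_sq_sum_le_of_orthogonal {Ω : Type*} [MeasurableSpace Ω] {μ : Measure Ω}
    [IsProbabilityMeasure μ] {Z : ℕ → Ω → ℝ} (hZm : ∀ t, Measurable (Z t))
    (hZ1 : ∀ t o, |Z t o| ≤ 1) (horth : ∀ s t, s < t → ∫ o, Z s o * Z t o ∂μ = 0) (n : ℕ) :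
    ∫ o, (∑ t ∈ Finset.range n, Z t o) ^ 2 ∂μ ≤ n := by
  have hb : ∀ s t o, ‖Z s o * Z t o‖ ≤ 1 := fun s t o => by
    rw [norm_mul]
    exact mul_le_one₀ (hZ1 s o) (norm_nonneg _) (hZ1 t o)
  have hint : ∀ s t, Integrable (fun o => Z s o * Z t o) μ := fun s t =>
    Integrable.of_bound ((hZm s).mul (hZm t)).aestronglyMeasurable 1 (ae_of_all _ (hb s t))
  have hcross : ∀ s t, ∫ o, Z s o * Z t o ∂μ ≤ if s = t then 1 else 0 := by
    intro s t
    split_ifs with h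
    · calc ∫ o, Z s o * Z t o ∂μ ≤ ∫ _, (1 : ℝ) ∂μ :=
            integral_mono (hint s t) (integrable_const _)
              fun o => (le_abs_self _).trans (hb s t o)
        _ = 1 := by simp
    · rcases lt_or_gt_of_ne h with h | h
      · exact (horth s t h).le
      · simp_rw [mul_comm (Z s _)]
        exact (horth t s h).le
  calc ∫ o, (∑ t ∈ Finset.range n, Z t o) ^ 2 ∂μ
      = ∑ s ∈ Finset.range n, ∑ t ∈ Finset.range n, ∫ o, Z s o * Z t o ∂μ := by
        simp_rw [sq, Finset.sum_mul_sum]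
        rw [integral_finsetSum _ fun s _ => integrable_finsetSum _ fun t _ => hint s t]
        exact Finset.sum_congr rfl fun s _ => integral_finsetSum _ fun t _ => hint s t
    _ ≤ ∑ s ∈ Finset.range n, ∑ t ∈ Finset.range n, if s = t then (1 : ℝ) else 0 :=
        Finset.sum_le_sum fun s _ => Finset.sum_le_sum fun t _ => hcross s t
    _ = n := by
        rw [Finset.sum_congr rfl fun s hs => (Finset.sum_ite_eq _ s _).trans (if_pos hs)]
        simp

/-- A strong law for bounded orthogonal random variables. The second moments of the averages are
summable along the squares, which gives convergence there; between consecutive squares `k ^ 2` and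
`(k + 1) ^ 2` the sum moves by at most `2 * k`. -/
theorem ae_tendsto_average_of_orthogonal {Ω : Type*} [MeasurableSpace Ω] {μ : Measure Ω}
    [IsProbabilityMeasure μ] {Z : ℕ → Ω → ℝ} (hZm : ∀ t, Measurable (Z t))
    (hZ1 : ∀ t o, |Z t o| ≤ 1) (horth : ∀ s t, s < t → ∫ o, Z s o * Z t o ∂μ = 0) :
    ∀ᵐ o ∂μ, Tendsto (fun n : ℕ => (∑ t ∈ Finset.range n, Z t o) / n) atTop (nhds 0) := by
  set S : ℕ → Ω → ℝ := fun n o => ∑ t ∈ Finset.range n, Z t o with hS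
  have hSm : ∀ n, Measurable (S n) := fun n => Finset.measurable_fun_sum _ fun t _ => hZm t
  have hSb : ∀ n o, |S n o| ≤ n := fun n o =>
    (Finset.abs_sum_le_sum_abs _ _).trans
      ((Finset.sum_le_sum fun t _ => hZ1 t o).trans (by simp))
  have hmom : ∀ k : ℕ, ∫⁻ o, ENNReal.ofReal ((S (k ^ 2) o / (k ^ 2 : ℕ)) ^ 2) ∂μ
      ≤ ENNReal.ofReal (1 / (k : ℝ) ^ 2) := by
    intro k
    have hi : Integrable (fun o => (S (k ^ 2) o) ^ 2) μ :=
      Integrable.of_bound ((hSm _).pow_const 2).aestronglyMeasurable (((k ^ 2 : ℕ) : ℝ) ^ 2)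
        (ae_of_all _ fun o => by
          rw [norm_pow]
          exact pow_le_pow_left₀ (norm_nonneg _) (hSb _ o) 2)
    rw [← ofReal_integral_eq_lintegral_ofReal]
    · apply ENNReal.ofReal_le_ofReal
      simp_rw [div_pow]
      rw [integral_div]
      have h := integral_sq_sum_le_of_orthogonal hZm hZ1 horth (k ^ 2)
      rcases Nat.eq_zero_or_pos k with rfl | hk
      · simp
      · have hk' : (0 : ℝ) < k := by exact_mod_cast hk
        rw [div_le_div_iff₀ (by positivity) (by positivity)]
        push_cast at h ⊢
        nlinarith [pow_pos hk' 2]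
    · simp_rw [div_pow]
      exact hi.div_const _
    · exact ae_of_all _ fun o => sq_nonneg _
  have hfin : ∀ᵐ o ∂μ, ∑' k : ℕ, ENNReal.ofReal ((S (k ^ 2) o / (k ^ 2 : ℕ)) ^ 2) < ∞ := by
    have hmeas : ∀ k : ℕ, Measurable fun o => ENNReal.ofReal ((S (k ^ 2) o / (k ^ 2 : ℕ)) ^ 2) :=
      fun k => (((hSm _).div_const _).pow_const 2).ennreal_ofReal
    refine ae_lt_top (Measurable.tsum hmeas) (ne_of_lt ?_)
    rw [lintegral_tsum fun k => (hmeas k).aemeasurable]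
    refine (ENNReal.tsum_le_tsum hmom).trans_lt ?_
    rw [← ENNReal.ofReal_tsum_of_nonneg (fun k => by positivity)
      (Real.summable_one_div_nat_pow.2 one_lt_two)]
    exact ENNReal.ofReal_lt_top
  filter_upwards [hfin] with o ho
  have hsq : Tendsto (fun k : ℕ => |S (k ^ 2) o / (k ^ 2 : ℕ)|) atTop (nhds 0) := by
    have h1 := ENNReal.tendsto_atTop_zero_of_tsum_ne_top ho.ne
    have h2 := (ENNReal.tendsto_toReal ENNReal.zero_ne_top).comp h1
    have h3 : Tendsto (fun k : ℕ => (S (k ^ 2) o / (k ^ 2 : ℕ)) ^ 2) atTop (nhds 0) := by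
      refine h2.congr fun k => ?_
      simp [ENNReal.toReal_ofReal (sq_nonneg _)]
    have h4 := (Real.continuous_sqrt.tendsto 0).comp h3
    rw [Real.sqrt_zero] at h4
    exact h4.congr fun k => Real.sqrt_sq_eq_abs _
  have hsqrt : Tendsto Nat.sqrt atTop atTop :=
    tendsto_atTop.2 fun b => (eventually_ge_atTop (b * b)).mono fun n hn => Nat.le_sqrt.2 hn
  have hbound : Tendsto (fun n : ℕ => |S (n.sqrt ^ 2) o / (n.sqrt ^ 2 : ℕ)| + 2 / (n.sqrt : ℝ))
      atTop (nhds 0) := by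
    have h := (hsq.add ((tendsto_const_div_atTop_nhds_zero_nat (2 : ℝ)))).comp hsqrt
    rw [add_zero] at h
    exact h
  refine squeeze_zero_norm' ?_ hbound
  filter_upwards [eventually_ge_atTop 1] with n hn
  have hk : 0 < n.sqrt := Nat.sqrt_pos.2 hn
  have hkn : n.sqrt ^ 2 ≤ n := Nat.sqrt_le' n
  have hkn' : n ≤ n.sqrt ^ 2 + 2 * n.sqrt := by
    have := Nat.sqrt_le_add n
    nlinarith
  generalize n.sqrt = k at *
  have hkR : (0 : ℝ) < k := by exact_mod_cast hk
  have hnR : ((k : ℝ) ^ 2) ≤ n := by exact_mod_cast hkn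
  have hstep : |S n o| ≤ |S (k ^ 2) o| + 2 * k := by
    have hsplit : S n o = S (k ^ 2) o + ∑ t ∈ Finset.Ico (k ^ 2) n, Z t o := by
      rw [hS]
      exact (Finset.sum_range_add_sum_Ico _ hkn).symm
    have htail : |∑ t ∈ Finset.Ico (k ^ 2) n, Z t o| ≤ 2 * k := by
      refine (Finset.abs_sum_le_sum_abs _ _).trans
        ((Finset.sum_le_sum fun t _ => hZ1 t o).trans ?_)
      simp only [Finset.sum_const, Nat.card_Ico, nsmul_eq_mul, mul_one]
      have : n - k ^ 2 ≤ 2 * k := by omega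
      exact_mod_cast this
    rw [hsplit]
    exact (abs_add_le _ _).trans (by linarith)
  rw [Real.norm_eq_abs, abs_div, abs_div, Nat.abs_cast, Nat.abs_cast]
  calc |S n o| / n ≤ (|S (k ^ 2) o| + 2 * k) / n := by gcongr
    _ ≤ (|S (k ^ 2) o| + 2 * k) / (k ^ 2 : ℕ) := by
        push_cast
        gcongr
    _ = |S (k ^ 2) o| / (k ^ 2 : ℕ) + 2 / k := by
        push_cast
        field_simp

/-! ### The maximal ergodic inequality -/

/-- The largest of the sums `f x + f (θ x) + ⋯ + f (θ^[k - 1] x)` with `0 ≤ k ≤ n`, defined by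
recursion on `n`; the value for `k = 0` is `0`. -/
def maxBirkhoffSum {Ω : Type*} (θ : Ω → Ω) (f : Ω → ℝ) : ℕ → Ω → ℝ
  | 0, _ => 0
  | n + 1, x => max 0 (f x + maxBirkhoffSum θ f n (θ x))

theorem maxBirkhoffSum_nonneg {Ω : Type*} (θ : Ω → Ω) (f : Ω → ℝ) (n : ℕ) (x : Ω) :
    0 ≤ maxBirkhoffSum θ f n x := by
  cases n with
  | zero => exact le_rfl
  | succ n => exact le_max_left _ _

theorem maxBirkhoffSum_le_succ {Ω : Type*} (θ : Ω → Ω) (f : Ω → ℝ) (n : ℕ) (x : Ω) :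
    maxBirkhoffSum θ f n x ≤ maxBirkhoffSum θ f (n + 1) x := by
  induction n generalizing x with
  | zero => exact le_max_left _ _
  | succ n ih => exact max_le_max le_rfl (by gcongr; exact ih _)

theorem birkhoffSum_le_maxBirkhoffSum {Ω : Type*} (θ : Ω → Ω) (f : Ω → ℝ) {k n : ℕ} (hk : k ≤ n)
    (x : Ω) : birkhoffSum θ f k x ≤ maxBirkhoffSum θ f n x := by
  induction n generalizing k x with
  | zero => simp [Nat.le_zero.1 hk, maxBirkhoffSum]
  | succ n ih =>
    cases k with
    | zero => simpa using maxBirkhoffSum_nonneg θ f (n + 1) x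
    | succ k =>
      rw [birkhoffSum_succ']
      exact le_max_of_le_right (by gcongr; exact ih (Nat.le_of_succ_le_succ hk) _)

theorem measurable_maxBirkhoffSum {Ω : Type*} [MeasurableSpace Ω] {θ : Ω → Ω} {f : Ω → ℝ}
    (hθ : Measurable θ) (hf : Measurable f) (n : ℕ) : Measurable (maxBirkhoffSum θ f n) := by
  induction n with
  | zero => exact measurable_const
  | succ n ih => exact measurable_const.max (hf.add (ih.comp hθ))

theorem integrable_maxBirkhoffSum {Ω : Type*} [MeasurableSpace Ω] {μ : Measure Ω} {θ : Ω → Ω}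
    {f : Ω → ℝ} (hθ : MeasurePreserving θ μ μ) (hf : Integrable f μ) (n : ℕ) :
    Integrable (maxBirkhoffSum θ f n) μ := by
  induction n with
  | zero => exact integrable_zero _ _ _
  | succ n ih =>
    exact (integrable_zero _ _ _).sup (hf.add (hθ.integrable_comp_of_integrable ih))

/-- The maximal ergodic inequality, by Garsia's argument: where the maximum `M n` of the partial
sums of `f = g - c` is positive, it is at most `f + M n ∘ θ`, and elsewhere it is `0`. As `θ`
preserves `μ`, integration gives `0 ≤ ∫ f` over the set where `M n` is positive. -/
theorem mul_measureReal_birkhoffSum_gt_le {Ω : Type*} [MeasurableSpace Ω] {μ : Measure Ω}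
    [IsProbabilityMeasure μ] {θ : Ω → Ω} (hθ : MeasurePreserving θ μ μ) {g : Ω → ℝ}
    (hgm : Measurable g) (hg : Integrable g μ) (hg0 : ∀ x, 0 ≤ g x) {c : ℝ} (hc : 0 ≤ c) (n : ℕ) :
    c * μ.real {x | ∃ k ≤ n, c * k < birkhoffSum θ g k x} ≤ ∫ x, g x ∂μ := by
  set f : Ω → ℝ := fun x => g x - c with hf
  have hfm : Measurable f := hgm.sub_const c
  have hfi : Integrable f μ := hg.sub (integrable_const c)
  set M := maxBirkhoffSum θ f n with hM
  have hMi : Integrable M μ := integrable_maxBirkhoffSum hθ hfi n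
  have hMθ : Integrable (fun x => M (θ x)) μ := hθ.integrable_comp_of_integrable hMi
  have hMm : Measurable M := measurable_maxBirkhoffSum hθ.measurable hfm n
  set A : Set Ω := {x | 0 < M x} with hA
  have hAm : MeasurableSet A := measurableSet_lt measurable_const hMm
  have hsub : {x | ∃ k ≤ n, c * k < birkhoffSum θ g k x} ⊆ A := by
    rintro x ⟨k, hk, hlt⟩
    refine lt_of_lt_of_le ?_ (birkhoffSum_le_maxBirkhoffSum θ f hk x)
    have : birkhoffSum θ f k x = birkhoffSum θ g k x - c * k := by
      simp [birkhoffSum, hf, Finset.sum_sub_distrib, mul_comm]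
    rw [this]
    linarith
  have hpt : ∀ x, M x ≤ A.indicator f x + M (θ x) := by
    intro x
    by_cases hx : x ∈ A
    · rw [Set.indicator_of_mem hx]
      cases n with
      | zero => exact absurd hx (lt_irrefl (0 : ℝ))
      | succ n =>
        have hx' : 0 < max 0 (f x + maxBirkhoffSum θ f n (θ x)) := hx
        have h1 : M x = f x + maxBirkhoffSum θ f n (θ x) :=
          max_eq_right (not_lt.1 fun h => by rw [max_eq_left h.le] at hx'; exact lt_irrefl _ hx')
        rw [h1]
        gcongr
        exact maxBirkhoffSum_le_succ θ f n (θ x)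
    · rw [Set.indicator_of_notMem hx, zero_add]
      exact (not_lt.1 hx).trans (maxBirkhoffSum_nonneg θ f n _)
  have hint : 0 ≤ ∫ x in A, f x ∂μ := by
    have h1 : ∫ x, M x ∂μ ≤ ∫ x, (A.indicator f x + M (θ x)) ∂μ :=
      integral_mono hMi ((hfi.indicator hAm).add hMθ) hpt
    rw [integral_add (hfi.indicator hAm) hMθ, integral_indicator hAm] at h1
    have h2 : ∫ x, M (θ x) ∂μ = ∫ x, M x ∂μ := by
      conv_rhs => rw [← hθ.map_eq]
      rw [integral_map hθ.measurable.aemeasurable hMm.aestronglyMeasurable]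
    linarith
  have hAg : c * μ.real A ≤ ∫ x in A, g x ∂μ := by
    rw [hf, integral_sub hg.integrableOn (integrable_const c)] at hint
    simp only [integral_const, smul_eq_mul, measureReal_restrict_apply_univ] at hint
    linarith [mul_comm c (μ.real A)]
  calc c * μ.real {x | ∃ k ≤ n, c * k < birkhoffSum θ g k x} ≤ c * μ.real A :=
        mul_le_mul_of_nonneg_left (measureReal_mono hsub) hc
    _ ≤ ∫ x in A, g x ∂μ := hAg
    _ ≤ ∫ x, g x ∂μ := setIntegral_le_integral hg (ae_of_all _ hg0)

/-! ### Renewals driven by an independent sequence -/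

open Classical in
/-- The age process with renewal sets `A 1, A 2, …`: the age starts at `1`; at age `m`, the next
term of the sequence `y` causes a renewal, which resets the age to `1`, if it lies in `A m`, and
otherwise the age increases by `1`. Thus `renewalAge A y t` is the age when `y t` is inspected. -/
noncomputable def renewalAge {E : Type*} (A : ℕ → Set E) (y : ℕ → E) : ℕ → ℕ
  | 0 => 1
  | t + 1 => if y t ∈ A (renewalAge A y t) then 1 else renewalAge A y t + 1

theorem renewalAge_pos {E : Type*} (A : ℕ → Set E) (y : ℕ → E) (t : ℕ) :
    1 ≤ renewalAge A y t := by
  cases t with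
  | zero => exact le_rfl
  | succ t => rw [renewalAge]; split_ifs <;> omega

/-- At age `n + 1`, the last `n` inspections took place at the ages `1, …, n` without a renewal. -/
theorem exists_eq_add_of_renewalAge_eq {E : Type*} {A : ℕ → Set E} {y : ℕ → E} {t n : ℕ}
    (h : renewalAge A y t = n + 1) : ∃ s, t = s + n ∧ ∀ j < n, y (s + j) ∉ A (j + 1) := by
  induction t generalizing n with
  | zero =>
    have : n = 0 := by simpa [renewalAge, eq_comm] using h
    exact ⟨0, by omega, fun j hj => by omega⟩
  | succ t ih =>
    rw [renewalAge] at h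
    split_ifs at h with hy
    · exact ⟨t + 1, by omega, fun j hj => by omega⟩
    · obtain ⟨k, rfl⟩ : ∃ k, n = k + 1 := ⟨n - 1, by have := renewalAge_pos A y t; omega⟩
      have hk : renewalAge A y t = k + 1 := by omega
      obtain ⟨s, rfl, hs⟩ := ih hk
      refine ⟨s, by omega, fun j hj => ?_⟩
      rcases Nat.lt_succ_iff_lt_or_eq.1 hj with hj | rfl
      · exact hs j hj
      · rwa [hk] at hy

theorem dependsOn_renewalAge {E : Type*} (A : ℕ → Set E) (t : ℕ) :
    DependsOn (fun y => renewalAge A y t) (Set.Iio t) := by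
  induction t with
  | zero => exact fun _ _ _ => rfl
  | succ t ih =>
    intro x y hxy
    have h1 : renewalAge A x t = renewalAge A y t := ih fun i hi => hxy i (Nat.lt_succ_of_lt hi)
    have h2 : x t = y t := hxy t (Nat.lt_succ_self t)
    simp only [renewalAge]
    rw [h1, h2]

theorem measurable_renewalAge {E : Type*} [MeasurableSpace E] {A : ℕ → Set E}
    (hA : ∀ j, MeasurableSet (A j)) (t : ℕ) : Measurable fun y : ℕ → E => renewalAge A y t := by
  induction t with
  | zero => exact measurable_const
  | succ t ih =>
    refine Measurable.ite ?_ measurable_const (ih.add_const 1)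
    have : {y : ℕ → E | y t ∈ A (renewalAge A y t)}
        = ⋃ m, {y | renewalAge A y t = m} ∩ {y | y t ∈ A m} := by
      ext y
      simp
    rw [this]
    exact MeasurableSet.iUnion fun m =>
      (ih (measurableSet_singleton m)).inter (measurable_pi_apply t (hA m))

theorem indepFun_of_dependsOn_Iio {E : Type*} [MeasurableSpace E] (ν : Measure E)
    [IsProbabilityMeasure ν] {φ : (ℕ → E) → ℝ} (hφ : Measurable φ) {t : ℕ}
    (hdep : DependsOn φ (Set.Iio t)) :
    IndepFun φ (fun y => y t) (Measure.infinitePi fun _ : ℕ => ν) := by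
  classical
  obtain ⟨e⟩ : Nonempty E := nonempty_of_isProbabilityMeasure ν
  have hind : iIndepFun (fun (i : ℕ) (y : ℕ → E) => y i) (Measure.infinitePi fun _ : ℕ => ν) :=
    iIndepFun_infinitePi (X := fun _ y => y) fun _ => measurable_id
  have h := hind.indepFun_finset (Finset.range t) {t} (by simp) fun i => measurable_pi_apply i
  set ext : (↥(Finset.range t) → E) → (ℕ → E) :=
    fun z i => if hi : i ∈ Finset.range t then z ⟨i, hi⟩ else e with hext
  have hextm : Measurable ext := by
    refine measurable_pi_lambda _ fun i => ?_
    by_cases hi : i ∈ Finset.range t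
    · simp only [hext, hi, dif_pos]
      exact measurable_pi_apply _
    · simp only [hext, hi, dif_neg, not_false_eq_true]
      exact measurable_const
  have h' := h.comp (hφ.comp hextm)
    (measurable_pi_apply (⟨t, Finset.mem_singleton_self t⟩ : ({t} : Finset ℕ)))
  have hφext : φ = (φ ∘ ext) ∘ fun y i => y i := by
    funext y
    refine hdep fun i hi => ?_
    have hi' : i < t := hi
    simp [hext, hi']
  rw [hφext]
  exact h'

/-- Along an independent sequence with common law `ν`, the terms inspected at times that are
selected predictably fall into `B` with asymptotic frequency `ν B`. -/
theorem ae_tendsto_average_predictable {E : Type*} [MeasurableSpace E] (ν : Measure E)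
    [IsProbabilityMeasure ν] {G : ℕ → (ℕ → E) → Prop} [∀ t y, Decidable (G t y)]
    (hG : ∀ t, MeasurableSet {y | G t y})
    (hdep : ∀ t, DependsOn (G t) (Set.Iio t)) {B : Set E} [DecidablePred (· ∈ B)]
    (hB : MeasurableSet B) :
    ∀ᵐ y ∂(Measure.infinitePi fun _ : ℕ => ν),
      Tendsto (fun T : ℕ => (((Finset.range T).filter fun t => G t y ∧ y t ∈ B).card
        - ν.real B * ((Finset.range T).filter fun t => G t y).card : ℝ) / T)
        atTop (nhds 0) := by
  set κ := Measure.infinitePi fun _ : ℕ => ν with hκ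
  set u : ℕ → (ℕ → E) → ℝ := fun t => {y | G t y}.indicator 1 with hu
  set v : E → ℝ := fun x => B.indicator 1 x - ν.real B with hv
  have hum : ∀ t, Measurable (u t) := fun t => measurable_one.indicator (hG t)
  have hvm : Measurable v := (measurable_one.indicator hB).sub_const _
  have hu01 : ∀ t y, |u t y| ≤ 1 := fun t y => by
    by_cases h : G t y <;> simp [hu, h]
  have hv1 : ∀ x, |v x| ≤ 1 := fun x => by
    have h0 : 0 ≤ ν.real B := measureReal_nonneg
    have h1 : ν.real B ≤ 1 := measureReal_le_one
    by_cases h : x ∈ B <;> simp only [hv, h, Set.indicator_of_mem, Set.indicator_of_notMem,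
      not_false_eq_true, Pi.one_apply] <;> rw [abs_le] <;> constructor <;> linarith
  have hudep : ∀ t, DependsOn (u t) (Set.Iio t) := fun t x y hxy => by
    have : (G t x) = (G t y) := hdep t hxy
    simp only [hu, Set.indicator_apply, Set.mem_ofPred_eq, this, Pi.one_apply]
  have hv0 : ∀ t, ∫ y, v (y t) ∂κ = 0 := by
    intro t
    have h1 : ∫ y, v (y t) ∂κ = ∫ x, v x ∂ν := by
      conv_rhs => rw [← Measure.infinitePi_map_eval (fun _ : ℕ => ν) t]
      rw [integral_map (measurable_pi_apply t).aemeasurable hvm.aestronglyMeasurable]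
    rw [h1, hv, integral_sub ((integrable_const 1).indicator hB) (integrable_const _),
      integral_indicator hB]
    simp
  have hlaw : ∀ᵐ y ∂κ, Tendsto (fun n : ℕ =>
      (∑ t ∈ Finset.range n, u t y * v (y t)) / n) atTop (nhds 0) := by
    refine ae_tendsto_average_of_orthogonal
      (fun t => (hum t).mul (hvm.comp (measurable_pi_apply t))) (fun t y => ?_) fun s t hst => ?_
    · rw [abs_mul]
      exact mul_le_one₀ (hu01 t y) (abs_nonneg _) (hv1 _)
    · have hφm : Measurable fun y : ℕ → E => u s y * v (y s) * u t y :=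
        ((hum s).mul (hvm.comp (measurable_pi_apply s))).mul (hum t)
      have hφd : DependsOn (fun y : ℕ → E => u s y * v (y s) * u t y) (Set.Iio t) := by
        intro x y hxy
        have e1 : u s x = u s y := hudep s fun i hi => hxy i (lt_trans hi hst)
        have e2 : u t x = u t y := hudep t hxy
        have e3 : x s = y s := hxy s hst
        simp only [e1, e2, e3]
      have hind := (indepFun_of_dependsOn_Iio ν hφm hφd).comp measurable_id hvm
      have h := hind.integral_fun_mul_eq_mul_integral hφm.aestronglyMeasurable
        (hvm.comp (measurable_pi_apply t)).aestronglyMeasurable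
      calc ∫ y, u s y * v (y s) * (u t y * v (y t)) ∂κ
          = ∫ y, (u s y * v (y s) * u t y) * v (y t) ∂κ := by simp_rw [mul_assoc]
        _ = (∫ y, (u s y * v (y s) * u t y) ∂κ) * ∫ y, v (y t) ∂κ := h
        _ = 0 := by rw [hv0 t, mul_zero]
  filter_upwards [hlaw] with y hy
  refine hy.congr fun T => ?_
  congr 1
  simp only [Finset.card_filter, Nat.cast_sum, Finset.mul_sum, ← Finset.sum_sub_distrib]
  refine Finset.sum_congr rfl fun t _ => ?_
  by_cases h1 : G t y <;> by_cases h2 : y t ∈ B <;> simp [hu, hv, h1, h2]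

/-- The probability `(1 - ν (A 1)) ⋯ (1 - ν (A n))` that `n` inspections after a renewal cause no
further renewal. -/
noncomputable def renewalSurvival {E : Type*} [MeasurableSpace E] (ν : Measure E) (A : ℕ → Set E)
    (n : ℕ) : ℝ :=
  ∏ j ∈ Finset.range n, (1 - ν.real (A (j + 1)))

theorem renewalSurvival_nonneg {E : Type*} [MeasurableSpace E] (ν : Measure E)
    [IsProbabilityMeasure ν] (A : ℕ → Set E) (n : ℕ) : 0 ≤ renewalSurvival ν A n :=
  Finset.prod_nonneg fun _ _ => sub_nonneg.2 measureReal_le_one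

theorem infinitePi_real_forall_notMem {E : Type*} [MeasurableSpace E] (ν : Measure E)
    [IsProbabilityMeasure ν] {A : ℕ → Set E} (hA : ∀ j, MeasurableSet (A j)) (n : ℕ) :
    (Measure.infinitePi fun _ : ℕ => ν).real {y | ∀ j < n, y j ∉ A (j + 1)}
      = renewalSurvival ν A n := by
  have h : {y : ℕ → E | ∀ j < n, y j ∉ A (j + 1)}
      = Set.pi (Finset.range n) fun j => (A (j + 1))ᶜ := by
    ext y
    simp
  rw [h, measureReal_def, Measure.infinitePi_pi _ fun j _ => (hA _).compl, ENNReal.toReal_prod]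
  exact Finset.prod_congr rfl fun j _ => probReal_compl_eq_one_sub (hA _)

theorem measurePreserving_shift {E : Type*} [MeasurableSpace E] (ν : Measure E)
    [IsProbabilityMeasure ν] :
    MeasurePreserving (fun (y : ℕ → E) i => y (i + 1)) (Measure.infinitePi fun _ : ℕ => ν)
      (Measure.infinitePi fun _ : ℕ => ν) :=
  ⟨by fun_prop, Measure.map_infinitePi_infinitePi_of_inj (P := fun _ : ℕ => ν)
    (f := fun i : ℕ => i + 1) (add_left_injective 1)⟩

theorem shift_iterate_apply {E : Type*} (y : ℕ → E) (s i : ℕ) :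
    (fun (y : ℕ → E) i => y (i + 1))^[s] y i = y (s + i) := by
  induction s generalizing y with
  | zero => simp
  | succ s ih => rw [Function.iterate_succ_apply, ih]; congr 1; omega

open Classical in
/-- A time at which the age exceeds `M` is determined by the time `s` of the preceding renewal and
by the number `n ≥ M` of inspections since then, none of which caused a renewal. -/
theorem card_renewalAge_gt_le {E : Type*} (A : ℕ → Set E) (y : ℕ → E) (M : ℕ) {T N : ℕ}
    (hTN : T ≤ N) :
    (((Finset.range T).filter fun t => M < renewalAge A y t).card : ℝ)
      ≤ birkhoffSum (fun (y : ℕ → E) i => y (i + 1)) (fun y => ∑ n ∈ Finset.Ico M N,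
        {y : ℕ → E | ∀ j < n, y j ∉ A (j + 1)}.indicator 1 y) T y := by
  have hval : birkhoffSum (fun (y : ℕ → E) i => y (i + 1)) (fun y => ∑ n ∈ Finset.Ico M N,
        {y : ℕ → E | ∀ j < n, y j ∉ A (j + 1)}.indicator (1 : (ℕ → E) → ℝ) y) T y
      = ((Finset.range T ×ˢ Finset.Ico M N).filter fun p => ∀ j < p.2,
          y (p.1 + j) ∉ A (j + 1)).card := by
    rw [Finset.card_filter, Finset.sum_product, Nat.cast_sum]
    refine Finset.sum_congr rfl fun s _ => ?_
    rw [Nat.cast_sum]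
    refine Finset.sum_congr rfl fun n _ => ?_
    simp only [Set.indicator_apply, Set.mem_ofPred_eq, shift_iterate_apply, Pi.one_apply,
      Nat.cast_ite, Nat.cast_one, Nat.cast_zero]
  rw [hval]
  have key : ∀ t, ∃ s, t = s + (renewalAge A y t - 1) ∧
      ∀ j < renewalAge A y t - 1, y (s + j) ∉ A (j + 1) := fun t =>
    exists_eq_add_of_renewalAge_eq (by have := renewalAge_pos A y t; omega)
  choose s hs hs' using key
  exact_mod_cast Finset.card_le_card_of_injOn (fun t => (s t, renewalAge A y t - 1))
    (fun t ht => by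
      have h := hs t
      simp only [Finset.coe_filter, Finset.mem_range, Set.mem_ofPred_eq, Finset.mem_product,
        Finset.mem_Ico] at ht ⊢
      exact ⟨by omega, hs' t⟩)
    (fun t _ t' _ h => by
      have h1 := hs t
      have h2 := hs t'
      simp only [Prod.mk.injEq] at h
      omega)

open Classical in
/-- If the mean time between renewals is finite, then high ages are rare. The number of times with
age above `M` is at most a Birkhoff sum of a function whose mean is a tail of the series of the
survival probabilities, and the maximal ergodic inequality controls all these sums at once. -/
theorem ae_forall_exists_card_renewalAge_gt_le {E : Type*} [MeasurableSpace E] (ν : Measure E)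
    [IsProbabilityMeasure ν] {A : ℕ → Set E} (hA : ∀ j, MeasurableSet (A j))
    (hsum : Summable (renewalSurvival ν A)) {ε : ℝ} (hε : 0 < ε) :
    ∀ᵐ y ∂(Measure.infinitePi fun _ : ℕ => ν), ∃ M, ∀ T : ℕ,
      (((Finset.range T).filter fun t => M < renewalAge A y t).card : ℝ) ≤ ε * T := by
  set κ := Measure.infinitePi fun _ : ℕ => ν with hκ
  set q := renewalSurvival ν A with hq
  set Bad : ℕ → ℕ → Set (ℕ → E) := fun M N => {y | ∃ T ≤ N,
    ε * T < ((Finset.range T).filter fun t => M < renewalAge A y t).card} with hBad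
  have hE : ∀ n, MeasurableSet {y : ℕ → E | ∀ j < n, y j ∉ A (j + 1)} := fun n => by
    have : {y : ℕ → E | ∀ j < n, y j ∉ A (j + 1)}
        = ⋂ j, ⋂ (_ : j < n), {y : ℕ → E | y j ∉ A (j + 1)} := by
      ext y
      simp
    rw [this]
    exact MeasurableSet.iInter fun j => MeasurableSet.iInter fun _ =>
      (hA (j + 1)).compl.preimage (measurable_pi_apply j)
  have hfinite : ∀ M N, κ (Bad M N) ≤ ENNReal.ofReal ((∑' n, q (n + M)) / ε) := by
    intro M N
    set g : (ℕ → E) → ℝ := fun y => ∑ n ∈ Finset.Ico M N,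
        {y : ℕ → E | ∀ j < n, y j ∉ A (j + 1)}.indicator 1 y with hg
    have hgi : Integrable g κ :=
      integrable_finsetSum _ fun n _ => (integrable_const (1 : ℝ)).indicator (hE n)
    have hgm : Measurable g :=
      Finset.measurable_fun_sum _ fun n _ => measurable_one.indicator (hE n)
    have hg0 : ∀ y, 0 ≤ g y := fun y =>
      Finset.sum_nonneg fun n _ => Set.indicator_nonneg (fun _ _ => zero_le_one) _
    have hmax := mul_measureReal_birkhoffSum_gt_le (measurePreserving_shift ν) hgm hgi hg0 hε.le N
    have hgint : ∫ y, g y ∂κ = ∑ n ∈ Finset.Ico M N, q n := by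
      have hi : ∀ n ∈ Finset.Ico M N, Integrable
          ({y : ℕ → E | ∀ j < n, y j ∉ A (j + 1)}.indicator (1 : (ℕ → E) → ℝ)) κ :=
        fun n _ => (integrable_const (1 : ℝ)).indicator (hE n)
      rw [hg, integral_finsetSum _ hi]
      refine Finset.sum_congr rfl fun n _ => ?_
      rw [hq, ← infinitePi_real_forall_notMem ν hA n]
      exact integral_indicator_one (hE n)
    have hle : ∑ n ∈ Finset.Ico M N, q n ≤ ∑' n, q (n + M) := by
      rw [Finset.sum_Ico_eq_sum_range]
      simp_rw [add_comm M]
      exact ((summable_nat_add_iff M).2 hsum).sum_le_tsum _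
        fun n _ => renewalSurvival_nonneg ν A _
    have hsub : Bad M N ⊆ {y | ∃ k ≤ N, ε * k
        < birkhoffSum (fun (y : ℕ → E) i => y (i + 1)) g k y} := by
      rintro y ⟨T, hT, hlt⟩
      exact ⟨T, hT, hlt.trans_le (card_renewalAge_gt_le A y M hT)⟩
    refine (measure_mono hsub).trans ?_
    rw [← ofReal_measureReal]
    refine ENNReal.ofReal_le_ofReal ?_
    rw [le_div_iff₀' hε]
    exact hmax.trans (hgint.trans_le hle)
  have hunion : ∀ M, κ (⋃ N, Bad M N) ≤ ENNReal.ofReal ((∑' n, q (n + M)) / ε) := by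
    intro M
    have hmono : Monotone (Bad M) := fun N N' h y ⟨T, hT, hlt⟩ => ⟨T, hT.trans h, hlt⟩
    rw [hmono.measure_iUnion]
    exact iSup_le (hfinite M)
  have hzero : κ (⋂ M, ⋃ N, Bad M N) = 0 := by
    have hlim : Tendsto (fun M => ENNReal.ofReal ((∑' n, q (n + M)) / ε)) atTop (nhds 0) := by
      have := (tendsto_sum_nat_add q).div_const ε
      rw [zero_div] at this
      simpa using ENNReal.tendsto_ofReal this
    exact le_antisymm (ge_of_tendsto' hlim fun M =>
      (measure_mono (Set.iInter_subset _ M)).trans (hunion M)) zero_le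
  rw [ae_iff]
  refine measure_mono_null (fun y hy => ?_) hzero
  simp only [Set.mem_ofPred_eq, not_exists, not_forall, not_le] at hy
  simp only [Set.mem_iInter, Set.mem_iUnion]
  intro M
  obtain ⟨T, hT⟩ := hy M
  exact ⟨T, T, le_rfl, hT⟩

/-! ### The long-run frequency of renewals of a given kind -/

/-- The deterministic part of the renewal argument. Here `c n T` is the number of times before `T`
with age `n + 1`, `ρ n` is the asymptotic proportion of these that pass on to age `n + 2`, and
`d n T` counts those where the event of interest occurs, with asymptotic proportion `a n`. Then
`c n T ≈ q n * c 0 T`; as all but few times have an age in a fixed finite range, `c 0 T / T` is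
asymptotically at least the reciprocal of the sum of the `q n`. -/
theorem eventually_mul_le_of_renewal_counts {c d : ℕ → ℕ → ℝ} {q ρ a : ℕ → ℝ} {S : ℕ → ℝ}
    (hq0 : ∀ n, 0 ≤ q n) (hq : Summable q) (hq1 : q 0 = 1) (hqs : ∀ n, q (n + 1) = q n * ρ n)
    (ha0 : ∀ n, 0 ≤ a n) (ha1 : ∀ n, a n ≤ 1) (hc0 : ∀ T, 0 ≤ c 0 T)
    (hc : ∀ n, Tendsto (fun T : ℕ => (c (n + 1) T - ρ n * c n T) / T) atTop (nhds 0))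
    (hd : ∀ n, Tendsto (fun T : ℕ => (d n T - a n * c n T) / T) atTop (nhds 0))
    (htail : ∀ ε > 0, ∃ M, ∀ T : ℕ, (T : ℝ) - ∑ n ∈ Finset.range M, c n T ≤ ε * T)
    (hS : ∀ M T, ∑ n ∈ Finset.range M, d n T ≤ S T)
    {r : ℝ} (hr : r < (∑' n, q n * a n) / ∑' n, q n) :
    ∀ᶠ T : ℕ in atTop, r * T ≤ S T := by
  set x : ℕ → ℝ := fun T => c 0 T / T with hx
  have hx0 : ∀ T, 0 ≤ x T := fun T => div_nonneg (hc0 T) (Nat.cast_nonneg T)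
  set Λ := ∑' n, q n with hΛ
  have hΛ1 : 1 ≤ Λ := hq1 ▸ hq.le_tsum 0 fun n _ => hq0 n
  have hΛ0 : 0 < Λ := by linarith
  have hqa : Summable fun n => q n * a n :=
    Summable.of_nonneg_of_le (fun n => mul_nonneg (hq0 n) (ha0 n))
      (fun n => mul_le_of_le_one_right (hq0 n) (ha1 n)) hq
  have hcx : ∀ n, Tendsto (fun T : ℕ => c n T / T - q n * x T) atTop (nhds 0) := by
    intro n
    induction n with
    | zero => simp [hx, hq1]
    | succ n ih =>
      have h := (hc n).add (ih.const_mul (ρ n))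
      simp only [mul_zero, add_zero] at h
      refine h.congr fun T => ?_
      rw [hqs]
      ring
  have hdx : ∀ n, Tendsto (fun T : ℕ => d n T / T - q n * a n * x T) atTop (nhds 0) := by
    intro n
    have h := (hd n).add ((hcx n).const_mul (a n))
    simp only [mul_zero, add_zero] at h
    refine h.congr fun T => ?_
    ring
  have hxlow : ∀ ε > 0, ∀ᶠ T : ℕ in atTop, 1 - ε ≤ Λ * x T := by
    intro ε hε
    obtain ⟨M, hM⟩ := htail (ε / 2) (by positivity)
    have hlim : Tendsto (fun T : ℕ => ∑ n ∈ Finset.range M, (c n T / T - q n * x T)) atTop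
        (nhds 0) := by
      simpa using tendsto_finsetSum (Finset.range M) fun n _ => hcx n
    filter_upwards [hlim.eventually_lt_const (half_pos hε), eventually_gt_atTop 0] with T hT hT0
    have hT0' : (0 : ℝ) < T := by exact_mod_cast hT0
    rw [Finset.sum_sub_distrib, ← Finset.sum_div, ← Finset.sum_mul] at hT
    have h1 : 1 - ε / 2 ≤ (∑ n ∈ Finset.range M, c n T) / T := by
      rw [le_div_iff₀ hT0']
      linarith [hM T]
    have h2 : (∑ n ∈ Finset.range M, q n) * x T ≤ Λ * x T :=
      mul_le_mul_of_nonneg_right (hq.sum_le_tsum _ fun n _ => hq0 n) (hx0 T)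
    linarith
  rw [lt_div_iff₀ hΛ0] at hr
  obtain ⟨M, hM⟩ := (hqa.hasSum.tendsto_sum_nat.eventually_const_lt hr).exists
  set V := ∑ n ∈ Finset.range M, q n * a n with hV
  have hV0 : 0 ≤ V := Finset.sum_nonneg fun n _ => mul_nonneg (hq0 n) (ha0 n)
  -- `ε` solves `(V / Λ) * (1 - ε) - ε = r`
  set ε := (V / Λ - r) / (V / Λ + 1) with hε
  have hVΛ : 0 ≤ V / Λ := div_nonneg hV0 hΛ0.le
  have hε0 : 0 < ε := div_pos (sub_pos.2 ((lt_div_iff₀ hΛ0).2 hM)) (by linarith)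
  have hεeq : V / Λ * (1 - ε) - ε = r := by
    have : ε * (V / Λ + 1) = V / Λ - r := div_mul_cancel₀ _ (by linarith)
    linarith
  have hlim : Tendsto (fun T : ℕ => ∑ n ∈ Finset.range M, (d n T / T - q n * a n * x T)) atTop
      (nhds 0) := by
    simpa using tendsto_finsetSum (Finset.range M) fun n _ => hdx n
  filter_upwards [hlim.eventually_const_lt (neg_lt_zero.2 hε0), hxlow ε hε0, eventually_gt_atTop 0]
    with T hT hxT hT0
  have hT0' : (0 : ℝ) < T := by exact_mod_cast hT0
  rw [Finset.sum_sub_distrib, ← Finset.sum_div, ← Finset.sum_mul, ← hV] at hT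
  have h1 : V / Λ * (1 - ε) ≤ V * x T := by
    calc V / Λ * (1 - ε) ≤ V / Λ * (Λ * x T) := mul_le_mul_of_nonneg_left hxT hVΛ
      _ = V * x T := by field_simp
  have h2 : r ≤ (∑ n ∈ Finset.range M, d n T) / T := by linarith
  rw [le_div_iff₀ hT0'] at h2
  exact h2.trans (hS M T)

open Classical in
theorem card_renewalAge_eq_succ {E : Type*} (A : ℕ → Set E) (y : ℕ → E) (n T : ℕ) :
    ((Finset.range (T + 1)).filter fun t => renewalAge A y t = n + 2).card
      + ((Finset.range T).filter fun t => renewalAge A y t = n + 1 ∧ y t ∈ A (n + 1)).card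
      = ((Finset.range T).filter fun t => renewalAge A y t = n + 1).card := by
  simp only [Finset.card_filter]
  induction T with
  | zero => simp [renewalAge]
  | succ T ih =>
    have hstep : (if renewalAge A y (T + 1) = n + 2 then 1 else 0)
        + (if renewalAge A y T = n + 1 ∧ y T ∈ A (n + 1) then 1 else 0)
        = if renewalAge A y T = n + 1 then 1 else 0 := by
      by_cases h : renewalAge A y T = n + 1
      · by_cases hy : y T ∈ A (n + 1) <;> simp [renewalAge, h, hy]
      · by_cases hy : y T ∈ A (renewalAge A y T) <;> simp [renewalAge, h, hy]
    have e1 := Finset.sum_range_succ (fun t => if renewalAge A y t = n + 2 then 1 else 0) (T + 1)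
    have e2 := Finset.sum_range_succ (fun t => if renewalAge A y t = n + 1 then 1 else 0) T
    have e3 := Finset.sum_range_succ
      (fun t => if renewalAge A y t = n + 1 ∧ y t ∈ A (n + 1) then 1 else 0) T
    omega

open Classical in
theorem tendsto_card_renewalAge_succ {E : Type*} {A : ℕ → Set E} {y : ℕ → E} {n : ℕ} {p : ℝ}
    (h : Tendsto (fun T : ℕ => (((Finset.range T).filter fun t =>
        renewalAge A y t = n + 1 ∧ y t ∈ A (n + 1)).card
      - p * ((Finset.range T).filter fun t => renewalAge A y t = n + 1).card : ℝ) / T)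
      atTop (nhds 0)) :
    Tendsto (fun T : ℕ => (((Finset.range T).filter fun t => renewalAge A y t = n + 2).card
      - (1 - p) * ((Finset.range T).filter fun t => renewalAge A y t = n + 1).card : ℝ) / T)
      atTop (nhds 0) := by
  have hbdd : Tendsto (fun T : ℕ => ((1 : ℝ) / T)) atTop (nhds 0) :=
    tendsto_const_div_atTop_nhds_zero_nat 1
  have hnorm := h.norm.add hbdd
  simp only [norm_zero, add_zero] at hnorm
  refine squeeze_zero_norm (fun T => ?_) hnorm
  have h1 := card_renewalAge_eq_succ A y n T
  have h2 : ((Finset.range (T + 1)).filter fun t => renewalAge A y t = n + 2).card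
      ≤ ((Finset.range T).filter fun t => renewalAge A y t = n + 2).card + 1 := by
    rw [Finset.range_add_one, Finset.filter_insert]
    split_ifs
    · exact Finset.card_insert_le _ _
    · omega
  have h3 : ((Finset.range T).filter fun t => renewalAge A y t = n + 2).card
      ≤ ((Finset.range (T + 1)).filter fun t => renewalAge A y t = n + 2).card := by
    gcongr
    omega
  rw [norm_div, norm_div, Real.norm_natCast, ← add_div]
  refine div_le_div_of_nonneg_right ?_ (Nat.cast_nonneg T)
  generalize ((Finset.range (T + 1)).filter fun t => renewalAge A y t = n + 2).card = u at *
  generalize ((Finset.range T).filter fun t => renewalAge A y t = n + 1 ∧ y t ∈ A (n + 1)).card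
    = v at *
  generalize ((Finset.range T).filter fun t => renewalAge A y t = n + 2).card = w at *
  generalize ((Finset.range T).filter fun t => renewalAge A y t = n + 1).card = z at *
  have h1' : (u : ℝ) + v = z := by exact_mod_cast h1
  have h2' : (u : ℝ) ≤ w + 1 := by exact_mod_cast h2
  have h3' : (w : ℝ) ≤ u := by exact_mod_cast h3
  rw [Real.norm_eq_abs, Real.norm_eq_abs, show (w : ℝ) - (1 - p) * z
    = -(v - p * z) + (w - u) by rw [← h1']; ring]
  refine (abs_add_le _ _).trans ?_
  rw [abs_neg]
  gcongr
  rw [abs_le]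
  constructor <;> linarith

open Classical in
theorem le_sum_card_renewalAge_add {E : Type*} (A : ℕ → Set E) (y : ℕ → E) (M T : ℕ) :
    (T : ℝ) ≤ (∑ n ∈ Finset.range M,
        (((Finset.range T).filter fun t => renewalAge A y t = n + 1).card : ℝ))
      + ((Finset.range T).filter fun t => M < renewalAge A y t).card := by
  have hcount : T ≤ (∑ n ∈ Finset.range M,
      ((Finset.range T).filter fun t => renewalAge A y t = n + 1).card)
      + ((Finset.range T).filter fun t => M < renewalAge A y t).card := by
    have hcover : Finset.range T ⊆ ((Finset.range M).biUnion fun n =>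
        (Finset.range T).filter fun t => renewalAge A y t = n + 1)
        ∪ (Finset.range T).filter fun t => M < renewalAge A y t := by
      intro t ht
      have hpos := renewalAge_pos A y t
      simp only [Finset.mem_union, Finset.mem_biUnion, Finset.mem_filter]
      by_cases h : M < renewalAge A y t
      · exact Or.inr ⟨ht, h⟩
      · exact Or.inl ⟨renewalAge A y t - 1, Finset.mem_range.2 (by omega), ht, by omega⟩
    calc T = (Finset.range T).card := (Finset.card_range T).symm
      _ ≤ _ := Finset.card_le_card hcover
      _ ≤ _ := (Finset.card_union_le _ _).trans
        (Nat.add_le_add_right Finset.card_biUnion_le _)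
  exact_mod_cast hcount

open Classical in
theorem sum_card_renewal_le {E : Type*} (A : ℕ → Set E) (B : Set E) (y : ℕ → E) (M T : ℕ) :
    ∑ n ∈ Finset.range M, (((Finset.range T).filter fun t =>
        renewalAge A y t = n + 1 ∧ y t ∈ A (n + 1) ∩ B).card : ℝ)
      ≤ ((Finset.range T).filter fun t => y t ∈ A (renewalAge A y t) ∩ B).card := by
  have hdisj : ∀ n ∈ Finset.range M, ∀ m ∈ Finset.range M, n ≠ m → Disjoint
      ((Finset.range T).filter fun t => renewalAge A y t = n + 1 ∧ y t ∈ A (n + 1) ∩ B)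
      ((Finset.range T).filter fun t => renewalAge A y t = m + 1 ∧ y t ∈ A (m + 1) ∩ B) := by
    intro n _ m _ hnm
    refine Finset.disjoint_filter.2 fun t _ h h' => hnm ?_
    have := h.1.symm.trans h'.1
    omega
  rw [← Nat.cast_sum, ← Finset.card_biUnion hdisj]
  refine Nat.cast_le.2 (Finset.card_le_card fun t ht => ?_)
  simp only [Finset.mem_biUnion, Finset.mem_filter] at ht ⊢
  obtain ⟨n, -, htT, hn, hy⟩ := ht
  exact ⟨htT, hn ▸ hy⟩

open Classical in
/-- In the long run, renewals at times `t` with `y t ∈ B` occur with at least the frequency that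
renewal theory predicts: the probability that a renewal cycle ends in `B`, divided by the mean
length of a cycle. -/
theorem ae_eventually_mul_le_card_renewal {E : Type*} [MeasurableSpace E] (ν : Measure E)
    [IsProbabilityMeasure ν] {A : ℕ → Set E} (hA : ∀ j, MeasurableSet (A j))
    (hsum : Summable (renewalSurvival ν A)) {B : Set E} (hB : MeasurableSet B) :
    ∀ᵐ y ∂(Measure.infinitePi fun _ : ℕ => ν),
      ∀ r < (∑' n, renewalSurvival ν A n * ν.real (A (n + 1) ∩ B)) / ∑' n, renewalSurvival ν A n,
        ∀ᶠ T : ℕ in atTop, r * T ≤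
          ((Finset.range T).filter fun t => y t ∈ A (renewalAge A y t) ∩ B).card := by
  have hmeas : ∀ n t, MeasurableSet {y : ℕ → E | renewalAge A y t = n} := fun n t =>
    measurable_renewalAge hA t (measurableSet_singleton n)
  have hdep : ∀ n t, DependsOn (fun y : ℕ → E => renewalAge A y t = n) (Set.Iio t) :=
    fun n t x y hxy => by
      have h : renewalAge A x t = renewalAge A y t := dependsOn_renewalAge A t hxy
      simp only [h]
  have hfreq : ∀ D : ℕ → Set E, (∀ n, MeasurableSet (D n)) →
      ∀ᵐ y ∂(Measure.infinitePi fun _ : ℕ => ν), ∀ n, Tendsto (fun T : ℕ =>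
        (((Finset.range T).filter fun t => renewalAge A y t = n + 1 ∧ y t ∈ D n).card
          - ν.real (D n) * ((Finset.range T).filter fun t => renewalAge A y t = n + 1).card : ℝ)
          / T) atTop (nhds 0) := fun D hD => by
    refine ae_all_iff.2 fun n => ?_
    filter_upwards [ae_tendsto_average_predictable ν (hmeas (n + 1)) (hdep (n + 1)) (hD n)]
      with y hy
    exact hy
  have htail : ∀ᵐ y ∂(Measure.infinitePi fun _ : ℕ => ν), ∀ k : ℕ, ∃ M, ∀ T : ℕ,
      (((Finset.range T).filter fun t => M < renewalAge A y t).card : ℝ) ≤ 1 / ((k : ℝ) + 1) * T :=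
    ae_all_iff.2 fun k => ae_forall_exists_card_renewalAge_gt_le ν hA hsum (by positivity)
  filter_upwards [hfreq _ fun n => hA (n + 1), hfreq _ fun n => (hA (n + 1)).inter hB, htail]
    with y hyA hyB hytail r hr
  refine eventually_mul_le_of_renewal_counts
    (c := fun n T => ((Finset.range T).filter fun t => renewalAge A y t = n + 1).card)
    (d := fun n T => ((Finset.range T).filter fun t =>
      renewalAge A y t = n + 1 ∧ y t ∈ A (n + 1) ∩ B).card)
    (ρ := fun n => 1 - ν.real (A (n + 1)))
    (renewalSurvival_nonneg ν A) hsum (by simp [renewalSurvival])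
    (fun n => by simp [renewalSurvival, Finset.prod_range_succ])
    (fun n => measureReal_nonneg) (fun n => measureReal_le_one) (fun T => Nat.cast_nonneg _)
    (fun n => tendsto_card_renewalAge_succ (hyA n)) (fun n => by convert hyB n) (fun ε hε => ?_)
    (sum_card_renewal_le A B y) hr
  obtain ⟨k, hk⟩ := exists_nat_one_div_lt hε
  obtain ⟨M, hM⟩ := hytail k
  refine ⟨M, fun T => ?_⟩
  have hcount := le_sum_card_renewalAge_add A y M T
  have hT := hM T
  have hkT : 1 / ((k : ℝ) + 1) * T ≤ ε * T := by gcongr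
  linarith

/-- If an inspection at age `n + 1` causes a renewal outside `B` with probability at most `f n`, then
a renewal cycle ends in `B` with probability at least `1 - ∑ f n`. The probabilities that it ends at
age `n + 1` are the differences of the survival probabilities, which tend to `0`. -/
theorem one_sub_tsum_le_tsum_renewalSurvival_mul {E : Type*} [MeasurableSpace E] (ν : Measure E)
    [IsProbabilityMeasure ν] {A : ℕ → Set E} (hsum : Summable (renewalSurvival ν A)) {B : Set E}
    (hB : MeasurableSet B) {f : ℕ → ℝ} (hf : ∀ n, ν.real (A (n + 1) ∩ Bᶜ) ≤ f n)
    (hfs : Summable f) :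
    1 - ∑' n, f n ≤ ∑' n, renewalSurvival ν A n * ν.real (A (n + 1) ∩ B) := by
  set q := renewalSurvival ν A with hq
  have hq0 : ∀ n, 0 ≤ q n := renewalSurvival_nonneg ν A
  have hq1 : ∀ n, q n ≤ 1 := fun n =>
    Finset.prod_le_one (fun _ _ => sub_nonneg.2 measureReal_le_one)
      fun _ _ => sub_le_self _ measureReal_nonneg
  have hs : Summable fun n => q n * ν.real (A (n + 1) ∩ B) :=
    Summable.of_nonneg_of_le (fun n => mul_nonneg (hq0 n) measureReal_nonneg)
      (fun n => mul_le_of_le_one_right (hq0 n) measureReal_le_one) hsum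
  have hterm : ∀ n, (q n - q (n + 1)) - f n ≤ q n * ν.real (A (n + 1) ∩ B) := by
    intro n
    have h1 : q (n + 1) = q n * (1 - ν.real (A (n + 1))) := by
      simp [hq, renewalSurvival, Finset.prod_range_succ]
    have h2 : ν.real (A (n + 1)) = ν.real (A (n + 1) ∩ B) + ν.real (A (n + 1) ∩ Bᶜ) := by
      rw [← Set.sdiff_eq, measureReal_inter_add_sdiff hB]
    have h3 : q n * ν.real (A (n + 1) ∩ Bᶜ) ≤ f n :=
      (mul_le_of_le_one_left measureReal_nonneg (hq1 n)).trans (hf n)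
    rw [h1, h2]
    linarith
  have hlim : Tendsto (fun N => 1 - q N - ∑ n ∈ Finset.range N, f n) atTop
      (nhds (1 - 0 - ∑' n, f n)) :=
    (tendsto_const_nhds.sub hsum.tendsto_atTop_zero).sub hfs.hasSum.tendsto_sum_nat
  rw [sub_zero] at hlim
  refine le_of_tendsto_of_tendsto' hlim hs.hasSum.tendsto_sum_nat fun N => ?_
  calc 1 - q N - ∑ n ∈ Finset.range N, f n
      = ∑ n ∈ Finset.range N, ((q n - q (n + 1)) - f n) := by
        rw [Finset.sum_sub_distrib, Finset.sum_range_sub']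
        simp [hq, renewalSurvival]
    _ ≤ _ := Finset.sum_le_sum fun n _ => hterm n

/-! ### Comparison of LORD++ with a renewal process -/

theorem lordDiscoveries_subset (α w₀ : ℝ) (γ : ℕ → ℝ) (p : ℕ → ℝ) (T : ℕ) :
    lordDiscoveries α w₀ γ p T ⊆ Finset.Icc 1 T := by
  induction T with
  | zero => simp [lordDiscoveries]
  | succ T ih =>
    have h : Finset.Icc 1 T ⊆ Finset.Icc 1 (T + 1) := Finset.Icc_subset_Icc_right (by omega)
    rw [lordDiscoveries]
    split_ifs
    · exact Finset.insert_subset (by simp) (ih.trans h)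
    · exact ih.trans h

/-- The renewal process whose test levels are `(α - w₀) * γ 1, (α - w₀) * γ 2, …` after each
renewal never uses a larger level than LORD++: its multiplier is the smaller one of LORD++, and
its age is at least the time since the last discovery of LORD++. The two claims, on the ages and on
the discoveries, are proved by a joint induction. -/
theorem lord_age_le_renewalAge {h : ℕ → Bool} {p : ℕ → ℝ} {α w₀ : ℝ} (hw₀ : 0 ≤ w₀) (hw₁ : w₀ < α)
    {γ : ℕ → ℝ} (hγ₀ : ∀ t, 1 ≤ t → 0 ≤ γ t) (hγ_anti : AntitoneOn γ (Set.Ici 1)) (T : ℕ) :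
    T + 1 - (lordDiscoveries α w₀ γ p T).sup id
        ≤ renewalAge (fun j => {x : Bool × ℝ | x.2 ≤ (α - w₀) * γ j})
          (fun t => (h (t + 1), p (t + 1))) T ∧
      (p (T + 1) ≤ (α - w₀) * γ (renewalAge (fun j => {x : Bool × ℝ | x.2 ≤ (α - w₀) * γ j})
          (fun t => (h (t + 1), p (t + 1))) T) → T + 1 ∈ lordDiscoveries α w₀ γ p (T + 1)) := by
  set A : ℕ → Set (Bool × ℝ) := fun j => {x | x.2 ≤ (α - w₀) * γ j} with hA
  set y : ℕ → Bool × ℝ := fun t => (h (t + 1), p (t + 1)) with hy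
  have hrej : ∀ T, T + 1 - (lordDiscoveries α w₀ γ p T).sup id ≤ renewalAge A y T →
      p (T + 1) ≤ (α - w₀) * γ (renewalAge A y T) → T + 1 ∈ lordDiscoveries α w₀ γ p (T + 1) := by
    intro T hage hp
    have hsup : (lordDiscoveries α w₀ γ p T).sup id ≤ T := Finset.sup_le fun t ht =>
      (Finset.mem_Icc.1 (lordDiscoveries_subset α w₀ γ p T ht)).2
    have h1 : 1 ≤ T + 1 - (lordDiscoveries α w₀ γ p T).sup id := by omega
    have hlevel : (α - w₀) * γ (renewalAge A y T)
        ≤ lordLevel α w₀ γ (lordDiscoveries α w₀ γ p T) (T + 1) := by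
      rw [lordLevel, mul_comm]
      refine mul_le_mul (hγ_anti h1 (renewalAge_pos A y T) hage) ?_ (by linarith) (hγ₀ _ h1)
      rw [lordMultiplier]
      split_ifs <;> linarith
    rw [lordDiscoveries, if_pos (hp.trans hlevel)]
    exact Finset.mem_insert_self _ _
  have hage : T + 1 - (lordDiscoveries α w₀ γ p T).sup id ≤ renewalAge A y T := by
    induction T with
    | zero => simp [renewalAge]
    | succ T ih =>
      rw [renewalAge]
      split_ifs with hy'
      · have : T + 1 ≤ (lordDiscoveries α w₀ γ p (T + 1)).sup id :=
          Finset.le_sup (f := id) (hrej T ih hy')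
        omega
      · have : (lordDiscoveries α w₀ γ p T).sup id ≤ (lordDiscoveries α w₀ γ p (T + 1)).sup id := by
          refine Finset.sup_mono ?_
          rw [lordDiscoveries]
          split_ifs
          · exact Finset.subset_insert _ _
          · exact subset_rfl
        omega
  exact ⟨hage, hrej T hage⟩

theorem lordDiscoveries_mono (α w₀ : ℝ) (γ : ℕ → ℝ) (p : ℕ → ℝ) :
    Monotone (lordDiscoveries α w₀ γ p) := by
  refine monotone_nat_of_le_succ fun T => ?_
  rw [lordDiscoveries]
  split_ifs
  · exact Finset.subset_insert _ _
  · exact subset_rfl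

open Classical in
theorem card_renewal_le_card_lordDiscoveries {h : ℕ → Bool} {p : ℕ → ℝ} {α w₀ : ℝ} (hw₀ : 0 ≤ w₀)
    (hw₁ : w₀ < α) {γ : ℕ → ℝ} (hγ₀ : ∀ t, 1 ≤ t → 0 ≤ γ t) (hγ_anti : AntitoneOn γ (Set.Ici 1))
    (T : ℕ) :
    ((Finset.range T).filter fun t => ((h (t + 1), p (t + 1)) : Bool × ℝ) ∈
        (fun j => {x : Bool × ℝ | x.2 ≤ (α - w₀) * γ j})
          (renewalAge (fun j => {x : Bool × ℝ | x.2 ≤ (α - w₀) * γ j})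
            (fun t => (h (t + 1), p (t + 1))) t) ∩ {x : Bool × ℝ | x.1 = true}).card
      ≤ ((lordDiscoveries α w₀ γ p T).filter fun t => h t = true).card := by
  refine Finset.card_le_card_of_injOn (fun t => t + 1) (fun t ht => ?_)
    (fun t _ t' _ htt => Nat.succ_injective htt)
  simp only [Finset.coe_filter, Finset.mem_range, Set.mem_ofPred_eq, Set.mem_inter_iff] at ht ⊢
  exact ⟨lordDiscoveries_mono α w₀ γ p (Nat.succ_le_of_lt ht.1)
    ((lord_age_le_renewalAge hw₀ hw₁ hγ₀ hγ_anti t).2 ht.2.1), ht.2.2⟩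

theorem card_filter_range_add_one (h : ℕ → Bool) (T : ℕ) :
    ((Finset.range T).filter fun t => h (t + 1) = true).card
      = ((Finset.Icc 1 T).filter fun t => h t = true).card := by
  refine Finset.card_bij' (fun t _ => t + 1) (fun t _ => t - 1) ?_ ?_ ?_ ?_
  · intro t ht
    simp only [Finset.mem_filter, Finset.mem_range, Finset.mem_Icc] at ht ⊢
    exact ⟨by omega, ht.2⟩
  · intro t ht
    simp only [Finset.mem_filter, Finset.mem_range, Finset.mem_Icc] at ht ⊢
    exact ⟨by omega, by rw [Nat.sub_add_cancel ht.1.1]; exact ht.2⟩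
  · intro t _
    simp
  · intro t ht
    simp only [Finset.mem_filter, Finset.mem_Icc] at ht
    exact Nat.sub_add_cancel ht.1.1

theorem trueDiscoveryProportion_nonneg (h : ℕ → Bool) (A : Finset ℕ) (T : ℕ) :
    0 ≤ trueDiscoveryProportion h A T := by
  unfold trueDiscoveryProportion
  positivity

theorem trueDiscoveryProportion_le_one {h : ℕ → Bool} {A : Finset ℕ} {T : ℕ}
    (hA : A ⊆ Finset.Icc 1 T) : trueDiscoveryProportion h A T ≤ 1 := by
  unfold trueDiscoveryProportion
  refine div_le_one_of_le₀ (Nat.cast_le.2 ?_) (Nat.cast_nonneg _)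
  exact (Finset.card_le_card (Finset.filter_subset_filter _ hA)).trans (le_max_left _ _)

theorem measurable_weightedLordTDP {Ω : Type*} [MeasurableSpace Ω] {H : ℕ → Ω → Bool}
    {P w : ℕ → Ω → ℝ} (hH : ∀ t, 1 ≤ t → Measurable (H t)) (hP : ∀ t, 1 ≤ t → Measurable (P t))
    (hw : ∀ t, 1 ≤ t → Measurable (w t)) (α w₀ : ℝ) (γ : ℕ → ℝ) (T : ℕ) :
    Measurable (weightedLordTDP α w₀ γ H P w T) := by
  let _ : MeasurableSpace (Finset ℕ) := ⊤
  set D : ℕ → Ω → Finset ℕ := fun T o => lordDiscoveries α w₀ γ (fun t => P t o / w t o) T with hD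
  have hDm : ∀ T, Measurable (D T) := by
    intro T
    induction T with
    | zero => exact measurable_const
    | succ T ih =>
      have hF : Measurable fun x : Finset ℕ × Ω =>
          if P (T + 1) x.2 / w (T + 1) x.2 ≤ lordLevel α w₀ γ x.1 (T + 1) then
            insert (T + 1) x.1 else x.1 := by
        refine measurable_from_prod_countable_right fun S => ?_
        change Measurable fun o => if P (T + 1) o / w (T + 1) o ≤ lordLevel α w₀ γ S (T + 1) then
          insert (T + 1) S else S
        exact Measurable.ite (measurableSet_le ((hP _ (by omega)).div (hw _ (by omega)))
          measurable_const) measurable_const measurable_const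
      exact hF.comp (ih.prodMk measurable_id)
  have hnum : ∀ o, ((D T o).filter fun t => H t o = true).card
      = ∑ t ∈ Finset.Icc 1 T, if t ∈ D T o ∧ H t o = true then 1 else 0 := by
    intro o
    rw [← Finset.card_filter]
    congr 1
    ext t
    have := @lordDiscoveries_subset α w₀ γ (fun t => P t o / w t o) T t
    simp only [Finset.mem_filter]
    tauto
  have hHt : ∀ t ∈ Finset.Icc 1 T, MeasurableSet {o | H t o = true} := fun t ht =>
    hH t (Finset.mem_Icc.1 ht).1 (measurableSet_singleton true)
  have hnumm : Measurable fun o => ((D T o).filter fun t => H t o = true).card := by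
    simp_rw [hnum]
    refine Finset.measurable_fun_sum _ fun t ht => ?_
    exact Measurable.ite ((hDm T (MeasurableSpace.measurableSet_top (s := {S | t ∈ S}))).inter
      (hHt t ht)) measurable_const measurable_const
  have hden : Measurable fun o => ((Finset.Icc 1 T).filter fun t => H t o = true).card := by
    simp_rw [Finset.card_filter]
    exact Finset.measurable_fun_sum _ fun t ht =>
      Measurable.ite (hHt t ht) measurable_const measurable_const
  have hcast : Measurable fun n : ℕ => (n : ℝ) := measurable_from_top
  exact (hcast.comp hnumm).div (hcast.comp (hden.max measurable_const))

/-! ### The law of a single test in the mixture model -/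

namespace IsWeightedMixtureModel

variable {Ω 𝒳 : Type*} [MeasurableSpace Ω] [MeasurableSpace 𝒳] {μ : Measure Ω}
  {π₁ : ℝ} {L₀ L₁ : Measure 𝒳} {F₁ : Kernel 𝒳 ℝ} {Q₀ Q₁ : Measure ℝ}
  {H : ℕ → Ω → Bool} {X : ℕ → Ω → 𝒳} {P w : ℕ → Ω → ℝ}

theorem measurableSet_H_eq (hm : IsWeightedMixtureModel μ π₁ L₀ L₁ F₁ Q₀ Q₁ H X P w) {t : ℕ}
    (ht : 1 ≤ t) (h : Bool) : MeasurableSet {o | H t o = h} :=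
  hm.measurable_H t ht (measurableSet_singleton h)

theorem prob_null [IsProbabilityMeasure μ]
    (hm : IsWeightedMixtureModel μ π₁ L₀ L₁ F₁ Q₀ Q₁ H X P w) (hπ₀ : 0 ≤ π₁) {t : ℕ} (ht : 1 ≤ t) :
    μ {o | H t o = false} = ENNReal.ofReal (1 - π₁) := by
  have h : {o | H t o = false} = {o | H t o = true}ᶜ := by
    ext o
    simp
  rw [h, prob_compl_eq_one_sub (hm.measurableSet_H_eq ht true), hm.prob_alt t ht,
    ENNReal.ofReal_sub _ hπ₀, ENNReal.ofReal_one]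

theorem measure_inter_null [IsProbabilityMeasure μ] [IsProbabilityMeasure L₀]
    (hm : IsWeightedMixtureModel μ π₁ L₀ L₁ F₁ Q₀ Q₁ H X P w) (hπ₀ : 0 ≤ π₁) {t : ℕ} (ht : 1 ≤ t)
    {C : Set (ℝ × ℝ)} (hC : MeasurableSet C) :
    μ ({o | H t o = false} ∩ {o | (P t o, w t o) ∈ C})
      = ((volume.restrict (Set.Ioo (0 : ℝ) 1)).prod Q₀) C * ENNReal.ofReal (1 - π₁) := by
  have hP : Measure.map (P t) (cond μ {o | H t o = false})
      = volume.restrict (Set.Ioo (0 : ℝ) 1) := by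
    have h := congrArg (Measure.map Prod.snd) (hm.law_null t ht)
    rw [Measure.map_map measurable_snd ((hm.measurable_X t ht).prodMk (hm.measurable_P t ht)),
      Measure.map_snd_prod, measure_univ, one_smul] at h
    exact h
  have hPm := hm.measurable_P t ht
  have hwm := hm.measurable_w t ht
  have hjoint := (hm.cond_indep t ht false).map_prod_eq_prod_map_map hPm.aemeasurable
    hwm.aemeasurable
  rw [hP, hm.weight_null t ht] at hjoint
  rw [← cond_mul_eq_inter (hm.measurableSet_H_eq ht false), hm.prob_null hπ₀ ht, ← hjoint,
    Measure.map_apply (hPm.prodMk hwm) hC]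
  rfl

theorem measure_inter_alt [IsProbabilityMeasure μ]
    (hm : IsWeightedMixtureModel μ π₁ L₀ L₁ F₁ Q₀ Q₁ H X P w) {t : ℕ} (ht : 1 ≤ t)
    {C : Set (ℝ × ℝ)} (hC : MeasurableSet C) :
    μ ({o | H t o = true} ∩ {o | (P t o, w t o) ∈ C})
      = ((Measure.map Prod.snd (L₁ ⊗ₘ F₁)).prod Q₁) C * ENNReal.ofReal π₁ := by
  have hPm := hm.measurable_P t ht
  have hwm := hm.measurable_w t ht
  have hP : Measure.map (P t) (cond μ {o | H t o = true})
      = Measure.map Prod.snd (L₁ ⊗ₘ F₁) := by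
    rw [← hm.law_alt t ht, Measure.map_map measurable_snd ((hm.measurable_X t ht).prodMk hPm)]
    rfl
  have hjoint := (hm.cond_indep t ht true).map_prod_eq_prod_map_map hPm.aemeasurable
    hwm.aemeasurable
  rw [hP, hm.weight_alt t ht] at hjoint
  rw [← cond_mul_eq_inter (hm.measurableSet_H_eq ht true), hm.prob_alt t ht, ← hjoint,
    Measure.map_apply (hPm.prodMk hwm) hC]
  rfl

theorem measurable_weighted (hm : IsWeightedMixtureModel μ π₁ L₀ L₁ F₁ Q₀ Q₁ H X P w) {t : ℕ}
    (ht : 1 ≤ t) : Measurable fun o => (H t o, P t o / w t o) :=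
  (hm.measurable_H t ht).prodMk ((hm.measurable_P t ht).div (hm.measurable_w t ht))

/-- The pairs of a label and a weighted p-value are identically distributed: their law is determined
by the conditional laws of the p-values and of the weights. -/
theorem map_weighted_eq [IsProbabilityMeasure μ] [IsProbabilityMeasure L₀]
    (hm : IsWeightedMixtureModel μ π₁ L₀ L₁ F₁ Q₀ Q₁ H X P w) (hπ₀ : 0 ≤ π₁) {s t : ℕ}
    (hs : 1 ≤ s) (ht : 1 ≤ t) :
    Measure.map (fun o => (H s o, P s o / w s o)) μ
      = Measure.map (fun o => (H t o, P t o / w t o)) μ := by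
  ext S hS
  have hC : ∀ h : Bool, MeasurableSet {x : ℝ × ℝ | (h, x.1 / x.2) ∈ S} := fun h =>
    hS.preimage (measurable_const.prodMk (measurable_fst.div measurable_snd))
  have key : ∀ u, 1 ≤ u → Measure.map (fun o => (H u o, P u o / w u o)) μ S
      = ((Measure.map Prod.snd (L₁ ⊗ₘ F₁)).prod Q₁) {x | (true, x.1 / x.2) ∈ S}
          * ENNReal.ofReal π₁
        + ((volume.restrict (Set.Ioo (0 : ℝ) 1)).prod Q₀) {x | (false, x.1 / x.2) ∈ S}
          * ENNReal.ofReal (1 - π₁) := by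
    intro u hu
    rw [Measure.map_apply (hm.measurable_weighted hu) hS, ← hm.measure_inter_alt hu (hC true),
      ← hm.measure_inter_null hπ₀ hu (hC false),
      ← measure_inter_add_sdiff _ (hm.measurableSet_H_eq hu true)]
    congr 2
    · ext o
      simp only [Set.mem_inter_iff, Set.mem_preimage, Set.mem_ofPred_eq]
      constructor
      · rintro ⟨h1, h2⟩
        exact ⟨h2, h2 ▸ h1⟩
      · rintro ⟨h1, h2⟩
        exact ⟨h1.symm ▸ h2, h1⟩
    · ext o
      simp only [Set.mem_inter_iff, Set.mem_sdiff, Set.mem_preimage, Set.mem_ofPred_eq,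
        Bool.not_eq_true]
      constructor
      · rintro ⟨h1, h2⟩
        exact ⟨h2, h2 ▸ h1⟩
      · rintro ⟨h1, h2⟩
        exact ⟨h1.symm ▸ h2, h1⟩
  rw [key s hs, key t ht]

/-- A null hypothesis is rejected at level `a` with conditional probability
`E[min (a * w) 1] ≤ a * u₀ ≤ a`. -/
theorem measure_null_rejection_le [IsProbabilityMeasure μ] [IsProbabilityMeasure L₀]
    [IsProbabilityMeasure Q₀]
    (hm : IsWeightedMixtureModel μ π₁ L₀ L₁ F₁ Q₀ Q₁ H X P w) (hπ₀ : 0 ≤ π₁)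
    (hu₀ : ∫⁻ x, ENNReal.ofReal x ∂Q₀ ≤ 1) {t : ℕ} (ht : 1 ≤ t) {a : ℝ} (ha : 0 ≤ a) :
    μ {o | H t o = false ∧ P t o / w t o ≤ a}
      ≤ ENNReal.ofReal a * ENNReal.ofReal (1 - π₁) := by
  have hC : MeasurableSet {x : ℝ × ℝ | x.1 / x.2 ≤ a} :=
    measurableSet_le (measurable_fst.div measurable_snd) measurable_const
  have hset : {o | H t o = false ∧ P t o / w t o ≤ a}
      = {o | H t o = false} ∩ {o | (P t o, w t o) ∈ {x : ℝ × ℝ | x.1 / x.2 ≤ a}} := rfl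
  rw [hset, hm.measure_inter_null hπ₀ ht hC]
  gcongr
  rw [Measure.prod_apply_symm hC]
  have hpos : ∀ᵐ x ∂Q₀, 0 < x :=
    (prob_compl_eq_zero_iff measurableSet_Ioi).2 hm.null_weight_pos
  calc ∫⁻ x, (volume.restrict (Set.Ioo (0 : ℝ) 1)) ((fun p => (p, x)) ⁻¹' {x | x.1 / x.2 ≤ a}) ∂Q₀
      ≤ ∫⁻ x, ENNReal.ofReal a * ENNReal.ofReal x ∂Q₀ := by
        refine lintegral_mono_ae ?_
        filter_upwards [hpos] with x hx
        rw [Measure.restrict_apply (measurable_prodMk_right hC),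
          ← ENNReal.ofReal_mul ha]
        refine (measure_mono (t := Set.Ioc 0 (a * x)) fun p hp => ?_).trans (by simp)
        exact ⟨hp.2.1, (div_le_iff₀ hx).1 hp.1⟩
    _ = ENNReal.ofReal a * ∫⁻ x, ENNReal.ofReal x ∂Q₀ :=
        lintegral_const_mul _ ENNReal.measurable_ofReal
    _ ≤ ENNReal.ofReal a := mul_le_of_le_one_right zero_le hu₀

/-- The sequence of the labels and weighted p-values, shifted to start at `0`, has a product law. -/
theorem map_weighted_sequence [IsProbabilityMeasure μ] [IsProbabilityMeasure L₀]
    (hm : IsWeightedMixtureModel μ π₁ L₀ L₁ F₁ Q₀ Q₁ H X P w) (hπ₀ : 0 ≤ π₁) :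
    Measure.map (fun o t => (H (t + 1) o, P (t + 1) o / w (t + 1) o)) μ
      = Measure.infinitePi fun _ : ℕ => Measure.map (fun o => (H 1 o, P 1 o / w 1 o)) μ := by
  have hind := hm.indep.comp (fun _ (x : Bool × ℝ × ℝ) => (x.1, x.2.1 / x.2.2))
    fun _ => by fun_prop
  have h := hind.map_fun_eq_infinitePi_map fun t => hm.measurable_weighted (t := t + 1) (by omega)
  refine h.trans ?_
  congr 1
  funext t
  exact hm.map_weighted_eq hπ₀ (by omega) le_rfl

end IsWeightedMixtureModel

/-! ### The power of weighted LORD++ -/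

theorem powerLowerBound_eq_inv_tsum_renewalSurvival {E : Type*} [MeasurableSpace E] (ν : Measure E)
    [IsProbabilityMeasure ν] {A : ℕ → Set E} {b : ℝ} {γ : ℕ → ℝ} {D : ℝ → ℝ≥0∞}
    (hD : ∀ j, D (b * γ j) = ν (A j)) :
    powerLowerBound b γ D = (∑' m, ENNReal.ofReal (renewalSurvival ν A m))⁻¹ := by
  unfold powerLowerBound
  congr 2
  funext m
  rw [renewalSurvival, ENNReal.ofReal_prod_of_nonneg fun _ _ => sub_nonneg.2 measureReal_le_one,
    Finset.range_eq_Ico, Finset.prod_Ico_add' (fun j => ENNReal.ofReal (1 - ν.real (A j))) 0 m 1]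
  have hIcc : Finset.Icc 1 m = Finset.Ico (0 + 1) (m + 1) := by
    ext j
    simp only [Finset.mem_Icc, Finset.mem_Ico]
    omega
  rw [hIcc]
  refine Finset.prod_congr rfl fun j _ => ?_
  rw [hD, ENNReal.ofReal_sub _ measureReal_nonneg, ENNReal.ofReal_one, ofReal_measureReal]

/-- If non-null hypotheses have asymptotic frequency `π₁ > 0` and true discoveries have asymptotic
frequency at least `π₁ * κ`, then the true discovery proportion is asymptotically at least `κ`. -/
theorem ofReal_le_liminf_trueDiscoveryProportion {h : ℕ → Bool} {A : ℕ → Finset ℕ} {π₁ κ : ℝ}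
    (hπ₀ : 0 < π₁)
    (hN : Tendsto (fun T : ℕ => (((Finset.Icc 1 T).filter fun t => h t = true).card : ℝ) / T) atTop
      (nhds π₁))
    (hS : ∀ r < π₁ * κ, ∀ᶠ T : ℕ in atTop, r * T ≤ ((A T).filter fun t => h t = true).card) :
    ENNReal.ofReal κ
      ≤ liminf (fun T : ℕ => ENNReal.ofReal (trueDiscoveryProportion h (A T) T)) atTop := by
  refine le_of_forall_lt fun a ha => ?_
  obtain ⟨c, hac, hcκ⟩ := exists_between ha
  refine hac.trans_le ?_
  have hc_top : c ≠ ∞ := ne_top_of_lt hcκ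
  have hc : c.toReal < κ := by
    rwa [← ENNReal.ofReal_toReal hc_top, ENNReal.ofReal_lt_ofReal_iff_of_nonneg
      ENNReal.toReal_nonneg] at hcκ
  obtain ⟨r, hr1, hr2⟩ := exists_between (mul_lt_mul_of_pos_left hc hπ₀)
  have hcN := (hN.mul_const c.toReal).eventually_lt_const hr1
  refine le_liminf_of_le (by isBoundedDefault) ?_
  filter_upwards [hS r hr2, hcN, hN.eventually_const_lt hπ₀, eventually_gt_atTop 0]
    with T hST hNT hNpos hT
  have hT' : (0 : ℝ) < T := by exact_mod_cast hT
  rw [← ENNReal.ofReal_toReal hc_top]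
  refine ENNReal.ofReal_le_ofReal ?_
  have hN1 : 1 ≤ ((Finset.Icc 1 T).filter fun t => h t = true).card := by
    refine Nat.one_le_iff_ne_zero.2 fun h0 => ?_
    simp [h0] at hNpos
  have hN1' : (0 : ℝ) < ((Finset.Icc 1 T).filter fun t => h t = true).card := by
    exact_mod_cast hN1
  rw [trueDiscoveryProportion, max_eq_left hN1, le_div_iff₀ hN1']
  rw [div_mul_eq_mul_div, div_lt_iff₀ hT'] at hNT
  linarith

theorem ae_powerLowerBound_le_liminf_weightedLordTDP {Ω 𝒳 : Type*} [MeasurableSpace Ω]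
    [MeasurableSpace 𝒳] {μ : Measure Ω} [IsProbabilityMeasure μ] {π₁ : ℝ} (hπ₀ : 0 < π₁)
    (hπ₁ : π₁ < 1) {L₀ L₁ : Measure 𝒳} [IsProbabilityMeasure L₀] {F₁ : Kernel 𝒳 ℝ}
    {Q₀ Q₁ : Measure ℝ} [IsProbabilityMeasure Q₀] {H : ℕ → Ω → Bool} {X : ℕ → Ω → 𝒳}
    {P w : ℕ → Ω → ℝ} (hmodel : IsWeightedMixtureModel μ π₁ L₀ L₁ F₁ Q₀ Q₁ H X P w)
    (hu₀ : ∫⁻ x, ENNReal.ofReal x ∂Q₀ ≤ 1) {α w₀ : ℝ} (hα₁ : α ≤ 1) (hw₀ : 0 ≤ w₀) (hw₁ : w₀ < α)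
    {γ : ℕ → ℝ} (hγ₀ : ∀ t, 1 ≤ t → 0 ≤ γ t) (hγ_anti : AntitoneOn γ (Set.Ici 1))
    (hγ_sum : HasSum (fun t : ℕ => γ (t + 1)) 1) :
    ∀ᵐ o ∂μ, powerLowerBound (α - w₀) γ (weightedCDF μ P w)
      ≤ liminf (fun T : ℕ => ENNReal.ofReal (weightedLordTDP α w₀ γ H P w T o)) atTop := by
  classical
  set b := α - w₀ with hb
  have hb0 : 0 ≤ b := by linarith
  set A : ℕ → Set (Bool × ℝ) := fun j => {x | x.2 ≤ b * γ j} with hAdef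
  set B : Set (Bool × ℝ) := {x | x.1 = true} with hBdef
  have hA : ∀ j, MeasurableSet (A j) := fun j => measurableSet_le measurable_snd measurable_const
  have hB : MeasurableSet B := measurable_fst (measurableSet_singleton true)
  have hmeas1 := hmodel.measurable_weighted le_rfl
  set ν : Measure (Bool × ℝ) := Measure.map (fun o => (H 1 o, P 1 o / w 1 o)) μ with hν
  have : IsProbabilityMeasure ν := Measure.isProbabilityMeasure_map hmeas1.aemeasurable
  have hD : ∀ j, weightedCDF μ P w (b * γ j) = ν (A j) := fun j =>
    (Measure.map_apply hmeas1 (hA j)).symm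
  rw [powerLowerBound_eq_inv_tsum_renewalSurvival ν hD]
  set q := renewalSurvival ν A with hq
  have hq0 : ∀ n, 0 ≤ q n := renewalSurvival_nonneg ν A
  by_cases htop : ∑' m, ENNReal.ofReal (q m) = ∞
  · simp [htop]
  have hsum : Summable q := by
    refine (ENNReal.summable_toReal htop).congr fun n => ?_
    exact ENNReal.toReal_ofReal (hq0 n)
  have hΛ : 0 < ∑' n, q n :=
    hsum.tsum_pos hq0 0 (by simp [hq, renewalSurvival])
  rw [← ENNReal.ofReal_tsum_of_nonneg hq0 hsum, ← ENNReal.ofReal_inv_of_pos hΛ]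
  have hνB : ν.real B = π₁ := by
    rw [measureReal_def, hν, Measure.map_apply hmeas1 hB]
    exact (congrArg ENNReal.toReal (hmodel.prob_alt 1 le_rfl)).trans (ENNReal.toReal_ofReal hπ₀.le)
  have hfalse : ∀ n, ν.real (A (n + 1) ∩ Bᶜ) ≤ γ (n + 1) * (1 - π₁) := by
    intro n
    have hγn : 0 ≤ γ (n + 1) := hγ₀ _ (by omega)
    have hset : (fun o => (H 1 o, P 1 o / w 1 o)) ⁻¹' (A (n + 1) ∩ Bᶜ)
        = {o | H 1 o = false ∧ P 1 o / w 1 o ≤ b * γ (n + 1)} := by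
      ext o
      simp [hAdef, hBdef, and_comm]
    have h := hmodel.measure_null_rejection_le hπ₀.le hu₀ le_rfl (mul_nonneg hb0 hγn)
    rw [← hset, ← Measure.map_apply hmeas1 ((hA _).inter hB.compl),
      ← ENNReal.ofReal_mul (mul_nonneg hb0 hγn)] at h
    refine (ENNReal.toReal_le_of_le_ofReal
      (mul_nonneg (mul_nonneg hb0 hγn) (by linarith)) h).trans ?_
    refine mul_le_mul_of_nonneg_right ?_ (by linarith)
    exact mul_le_of_le_one_left hγn (by linarith)
  -- The false discoveries of a cycle have total probability at most `∑ γ (n + 1) * (1 - π₁)`.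
  have hV : π₁ ≤ ∑' n, q n * ν.real (A (n + 1) ∩ B) := by
    have h := one_sub_tsum_le_tsum_renewalSurvival_mul ν hsum hB hfalse
      (hγ_sum.summable.mul_right _)
    rw [(hγ_sum.mul_right (1 - π₁)).tsum_eq] at h
    linarith
  have hseqm : Measurable fun o (t : ℕ) => (H (t + 1) o, P (t + 1) o / w (t + 1) o) :=
    measurable_pi_lambda _ fun t => hmodel.measurable_weighted (by omega)
  have hfreq : ∀ᵐ y ∂(Measure.infinitePi fun _ : ℕ => ν), Tendsto (fun T : ℕ =>
      (((Finset.range T).filter fun t => (y t).1 = true).card : ℝ) / T) atTop (nhds π₁) := by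
    filter_upwards [ae_tendsto_average_predictable ν (G := fun _ _ => True)
      (fun _ => MeasurableSet.univ) (fun _ _ _ _ => rfl) hB] with y hy
    have h := hy.add_const π₁
    rw [zero_add, hνB] at h
    refine h.congr' ?_
    filter_upwards [eventually_gt_atTop 0] with T hT
    have hT' : (T : ℝ) ≠ 0 := by exact_mod_cast hT.ne'
    simp only [true_and, Finset.filter_true, Finset.card_range, hBdef, Set.mem_ofPred_eq]
    field_simp
    ring
  have hren := ae_eventually_mul_le_card_renewal ν hA hsum hB
  have hlaw : Measure.map (fun o (t : ℕ) => (H (t + 1) o, P (t + 1) o / w (t + 1) o)) μ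
      = Measure.infinitePi fun _ : ℕ => ν := hmodel.map_weighted_sequence hπ₀.le
  rw [← hlaw] at hfreq hren
  filter_upwards [ae_of_ae_map hseqm.aemeasurable hfreq, ae_of_ae_map hseqm.aemeasurable hren]
    with o hN hR
  refine ofReal_le_liminf_trueDiscoveryProportion hπ₀ ?_ fun r hr => ?_
  · refine hN.congr fun T => ?_
    rw [← card_filter_range_add_one (fun t => H t o) T]
  · have hr' : r < (∑' n, q n * ν.real (A (n + 1) ∩ B)) / ∑' n, q n := by
      refine hr.trans_le ?_
      rw [← div_eq_mul_inv]
      gcongr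
    filter_upwards [hR r hr'] with T hT
    refine hT.trans (Nat.cast_le.2 ?_)
    convert card_renewal_le_card_lordDiscoveries (h := fun t => H t o)
      (p := fun t => P t o / w t o) hw₀ hw₁ hγ₀ hγ_anti T

theorem theorem3 {Ω 𝒳 : Type*} [MeasurableSpace Ω] [MeasurableSpace 𝒳]
    (μ : Measure Ω) [IsProbabilityMeasure μ]
    (π₁ : ℝ) (hπ₀ : 0 < π₁) (hπ₁ : π₁ < 1)
    (L₀ L₁ : Measure 𝒳) [IsProbabilityMeasure L₀] [IsProbabilityMeasure L₁]
    (F₁ : Kernel 𝒳 ℝ) [IsMarkovKernel F₁]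
    (Q₀ Q₁ : Measure ℝ) [IsProbabilityMeasure Q₀] [IsProbabilityMeasure Q₁]
    (H : ℕ → Ω → Bool) (X : ℕ → Ω → 𝒳) (P w : ℕ → Ω → ℝ)
    (hmodel : IsWeightedMixtureModel μ π₁ L₀ L₁ F₁ Q₀ Q₁ H X P w)
    (hu₀ : ∫⁻ x, ENNReal.ofReal x ∂Q₀ ≤ 1)
    (α w₀ : ℝ) (hα₀ : 0 < α) (hα₁ : α < 1) (hw₀ : α / 2 ≤ w₀) (hw₁ : w₀ < α)
    (γ : ℕ → ℝ) (hγ₀ : ∀ t, 1 ≤ t → 0 ≤ γ t) (hγ_anti : AntitoneOn γ (Set.Ici 1))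
    (hγ_sum : HasSum (fun t : ℕ => γ (t + 1)) 1) :
    (∀ᵐ o ∂μ,
      powerLowerBound (α - w₀) γ (weightedCDF μ P w)
        ≤ liminf (fun T : ℕ => ENNReal.ofReal (weightedLordTDP α w₀ γ H P w T o)) atTop) ∧
    powerLowerBound (α - w₀) γ (weightedCDF μ P w)
      ≤ liminf (fun T : ℕ => ENNReal.ofReal (weightedLordTDR μ α w₀ γ H P w T)) atTop := by

  have hw₀' : 0 ≤ w₀ := by linarith
  have hae := ae_powerLowerBound_le_liminf_weightedLordTDP hπ₀ hπ₁ hmodel hu₀ hα₁.le hw₀' hw₁ hγ₀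
    hγ_anti hγ_sum
  refine ⟨hae, ?_⟩
  have hmeas : ∀ T, Measurable (weightedLordTDP α w₀ γ H P w T) := fun T =>
    measurable_weightedLordTDP hmodel.measurable_H hmodel.measurable_P hmodel.measurable_w α w₀ γ T
  have hnonneg : ∀ T o, 0 ≤ weightedLordTDP α w₀ γ H P w T o := fun T o =>
    trueDiscoveryProportion_nonneg _ _ _
  have hTDR : ∀ T, ENNReal.ofReal (weightedLordTDR μ α w₀ γ H P w T)
      = ∫⁻ o, ENNReal.ofReal (weightedLordTDP α w₀ γ H P w T o) ∂μ := fun T =>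
    ofReal_integral_eq_lintegral_ofReal
      (Integrable.of_bound (hmeas T).aestronglyMeasurable 1 (ae_of_all _ fun o => by
        rw [Real.norm_of_nonneg (hnonneg T o)]
        exact trueDiscoveryProportion_le_one (lordDiscoveries_subset _ _ _ _ _)))
      (ae_of_all _ (hnonneg T))
  simp_rw [hTDR]
  calc powerLowerBound (α - w₀) γ (weightedCDF μ P w)
      = ∫⁻ _, powerLowerBound (α - w₀) γ (weightedCDF μ P w) ∂μ := by simp
    _ ≤ ∫⁻ o, liminf (fun T : ℕ => ENNReal.ofReal (weightedLordTDP α w₀ γ H P w T o)) atTop ∂μ :=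
        lintegral_mono_ae hae
    _ ≤ _ := lintegral_liminf_le fun T => (hmeas T).ennreal_ofReal
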